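/- **Setting.** Let $\mathcal G_i=(X_i,Y_i;A_i,B_i,\lambda_i)$, $i=1,2$, be two non-local games, i.e. $X_i,Y_i,A_i,B_i$ are finite sets and $\lambda_i:X_i\times Y_i\times A_i\times B_i\to\{0,1\}$. Put $U_i=X_i\times Y_i$, $W_i=A_i\times B_i$, and let $\Lambda_i=\Lambda_{\mathcal G_i}\subseteq U_i\times W_i$ be the set of all $((x,y),(a,b))$ with $\lambda_i(x,y,a,b)=1$, with incidence matrix $A_{\Lambda_i}\in M_{U_i,W_i}(\{0,1\})$. A matrix over a unital $*$-algebra is a *magic unitary* if its entries are selfadjoint idempotents, each row and each column sums to $1$, and distinct entries in the same row, or in the same column, have product $0$. For $i,j\in\{1,2\}$ let $\mathcal O(\Lambda_i,\Lambda_j)$ be the universal unital complex $*$-algebra generated by the entries of two magic unitaries $P^U=(p^U_{u,u'})_{u\in U_i,u'\in U_j}$ and $P^W=(p^W_{w,w'})_{w\in W_i,w'\in W_j}$ subject to $A_{\Lambda_i}P^W=P^UA_{\Lambda_j}$. Put $\mathcal O(\Lambda_i):=\mathcal O(\Lambda_i,\Lambda_i)$, with generators written $u^U,u^W$; it is a Hopf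 $*$-algebra with $\Delta(u_{\alpha\beta})=\sum_\gamma u_{\alpha\gamma}\otimes u_{\gamma\beta}$, $\varepsilon(u_{\alpha\beta})=\delta_{\alpha\beta}$, $S(u_{\alpha\beta})=u_{\beta\alpha}$ on both blocks. Let $\delta:\mathcal O(\Lambda_1,\Lambda_2)\to\mathcal O(\Lambda_1)\otimes\mathcal O(\Lambda_1,\Lambda_2)$ and $\gamma:\mathcal O(\Lambda_1,\Lambda_2)\to\mathcal O(\Lambda_1,\Lambda_2)\otimes\mathcal O(\Lambda_2)$ be the unital $*$-homomorphisms with $\delta(p_{\alpha\beta})=\sum_{\gamma}u_{\alpha\gamma}\otimes p_{\gamma\beta}$ and $\gamma(p_{\alpha\beta})=\sum_{\gamma}p_{\alpha\gamma}\otimes u_{\gamma\beta}$ on both blocks. Let $I_{\mathrm{NS}}$ be the two-sided $*$-ideal of $\mathcal O(\Lambda_1,\Lambda_2)$ generated by the relations $$\sum_{x_1}p^U_{(x_1,y_1),(x_2,y_2)}=\sum_{x_1}p^U_{(x_1,y_1),(x_2',y_2)},\qquad \sum_{y_1}p^U_{(x_1,y_1),(x_2,y_2)}=\sum_{y_1}p^U_{(x_1,y_1),(x_2,y_2')},$$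 $$\sum_{a_2}p^W_{(a_1,b_1),(a_2,b_2)}=\sum_{a_2}p^W_{(a_1',b_1),(a_2,b_2)},\qquad \sum_{b_2}p^W_{(a_1,b_1),(a_2,b_2)}=\sum_{b_2}p^W_{(a_1,b_1'),(a_2,b_2)}$$ (for all values of the free indices), and let $\mathcal O_{\mathrm{NS}}=\mathcal O(\Lambda_1,\Lambda_2)/I_{\mathrm{NS}}$ with quotient map $q$. Let $J_i$ be the two-sided $*$-ideal of $\mathcal O(\Lambda_i)$ generated by $$\sum_{x}u^U_{(x,y),(x',y')}=\sum_{x}u^U_{(x,y),(x'',y')},\qquad \sum_{y}u^U_{(x,y),(x',y')}=\sum_{y}u^U_{(x,y),(x',y'')},$$ $$\sum_{a}u^W_{(a,b),(a',b')}=\sum_{a}u^W_{(a,b),(a'',b')},\qquad \sum_{b}u^W_{(a,b),(a',b')}=\sum_{b}u^W_{(a,b),(a',b'')},$$ and let $H_i=\mathcal O(\Lambda_i)/J_i$ with quotient map $\pi_i$. **Definition.** For Hopf $*$-algebras $H,K$, a unital $*$-algebra $Z$ with unital $*$-homomorphisms $\delta:Z\to H\otimes Z$ and $\gamma:Z\to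 Z\otimes K$ is an *$H$–$K$ bi-Galois extension* if $\delta$ is a coassociative and counital left coaction, $\gamma$ is a coassociative and counital right coaction, $(\delta\otimes\mathrm{id})\gamma=(\mathrm{id}\otimes\gamma)\delta$, and the canonical maps $\kappa_\delta:Z\otimes Z\to H\otimes Z$, $z\otimes z'\mapsto\delta(z)(1\otimes z')$, and $\kappa_\gamma:Z\otimes Z\to Z\otimes K$, $z\otimes z'\mapsto(z\otimes1)\gamma(z')$, are bijective. **Theorem.** $J_1$ and $J_2$ are Hopf $*$-ideals, so that $H_1$ and $H_2$ are Hopf $*$-algebras with the quotient structure. There are unital $*$-homomorphisms $\overline\delta:\mathcal O_{\mathrm{NS}}\to H_1\otimes\mathcal O_{\mathrm{NS}}$ and $\overline\gamma:\mathcal O_{\mathrm{NS}}\to\mathcal O_{\mathrm{NS}}\otimes H_2$ with $$\overline\delta\circ q=(\pi_1\otimes q)\circ\delta,\qquad \overline\gamma\circ q=(q\otimes\pi_2)\circ\gamma,$$ their canonical maps satisfy $$\kappa_{\overline\delta}\circ(q\otimes q)=(\pi_1\otimes q)\circ\kappa_\delta,\qquad \kappa_{\overline\gamma}\circ(q\otimes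 q)=(q\otimes\pi_2)\circ\kappa_\gamma,$$ and with the coactions $\overline\delta,\overline\gamma$ the $*$-algebra $\mathcal O_{\mathrm{NS}}$ is an $H_1$–$H_2$ bi-Galois extension. (All tensor products are algebraic, over $\mathbb C$.) -/

import Mathlib

open scoped TensorProduct

noncomputable section

namespace QIso

/-! ## Two-sided `*`-ideals and quotient `*`-algebras -/

section StarIdeal

variable {A : Type*} [Ring A] [StarRing A]

/-- An ideal is a `*`-ideal if it is closed under the involution. -/
class IsStarIdeal (I : Ideal A) : Prop where
  star_mem : ∀ ⦃a : A⦄, a ∈ I → star a ∈ I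

/-- The involution of `A ⧸ I`, for a two-sided `*`-ideal `I`: `star [a] = [star a]`. -/
instance quotientStarRing (I : Ideal A) [I.IsTwoSided] [IsStarIdeal I] : StarRing (A ⧸ I) where
  star x := Quotient.liftOn' x (fun a => Ideal.Quotient.mk I (star a)) (by
    intro a b h
    have h' : a - b ∈ I := (Submodule.quotientRel_def I).1 h
    refine Ideal.Quotient.eq.2 ?_
    rw [← star_sub]
    exact IsStarIdeal.star_mem h')
  star_involutive x := by
    obtain ⟨a, rfl⟩ := Ideal.Quotient.mk_surjective x
    exact congrArg (Ideal.Quotient.mk I) (star_star a)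
  star_mul x y := by
    obtain ⟨a, rfl⟩ := Ideal.Quotient.mk_surjective x
    obtain ⟨b, rfl⟩ := Ideal.Quotient.mk_surjective y
    exact congrArg (Ideal.Quotient.mk I) (star_mul a b)
  star_add x y := by
    obtain ⟨a, rfl⟩ := Ideal.Quotient.mk_surjective x
    obtain ⟨b, rfl⟩ := Ideal.Quotient.mk_surjective y
    exact congrArg (Ideal.Quotient.mk I) (star_add a b)

theorem star_mk (I : Ideal A) [I.IsTwoSided] [IsStarIdeal I] (a : A) :
    star (Ideal.Quotient.mk I a) = Ideal.Quotient.mk I (star a) := rfl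

instance quotientStarModule [Algebra ℂ A] [StarModule ℂ A] (I : Ideal A) [I.IsTwoSided]
    [IsStarIdeal I] : StarModule ℂ (A ⧸ I) where
  star_smul c x := by
    obtain ⟨a, rfl⟩ := Ideal.Quotient.mk_surjective x
    exact congrArg (Ideal.Quotient.mk I) (star_smul c a)

/-- The quotient map of a unital `*`-algebra by a two-sided `*`-ideal. -/
def quotientMap [Algebra ℂ A] (I : Ideal A) [I.IsTwoSided] [IsStarIdeal I] :
    A →⋆ₐ[ℂ] A ⧸ I :=
  { Ideal.Quotient.mkₐ ℂ I with map_star' := fun _ => rfl }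

@[simp] theorem quotientMap_apply [Algebra ℂ A] (I : Ideal A) [I.IsTwoSided] [IsStarIdeal I]
    (a : A) : quotientMap I a = Ideal.Quotient.mk I a := rfl

/-- The two-sided `*`-ideal generated by the differences `a - b`, for all relations `r a b`. -/
def starIdeal (r : A → A → Prop) : Ideal A :=
  (TwoSidedIdeal.span {c : A | ∃ a b, r a b ∧ (c = a - b ∨ c = star (a - b))}).asIdeal

instance starIdeal_isTwoSided (r : A → A → Prop) : (starIdeal r).IsTwoSided :=
  inferInstanceAs (TwoSidedIdeal.asIdeal _).IsTwoSided

theorem sub_mem_starIdeal {r : A → A → Prop} {a b : A} (h : r a b) : a - b ∈ starIdeal r :=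
  TwoSidedIdeal.subset_span ⟨a, b, h, Or.inl rfl⟩

instance starIdeal_isStarIdeal (r : A → A → Prop) : IsStarIdeal (starIdeal r) where
  star_mem a ha := by
    have ha' : a ∈ TwoSidedIdeal.span
      {c : A | ∃ a b, r a b ∧ (c = a - b ∨ c = star (a - b))} := ha
    change star a ∈ TwoSidedIdeal.span
      {c : A | ∃ a b, r a b ∧ (c = a - b ∨ c = star (a - b))}
    induction ha' using TwoSidedIdeal.span_induction with
    | mem x h =>
      obtain ⟨a, b, hr, rfl | rfl⟩ := h
      · exact TwoSidedIdeal.subset_span ⟨a, b, hr, Or.inr rfl⟩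
      · exact TwoSidedIdeal.subset_span ⟨a, b, hr, Or.inl (star_star _)⟩
    | zero => rw [star_zero]; exact TwoSidedIdeal.zero_mem _
    | add x y _ _ hx hy => rw [star_add]; exact TwoSidedIdeal.add_mem _ (hx ‹_›) (hy ‹_›)
    | neg x _ hx => rw [star_neg]; exact TwoSidedIdeal.neg_mem _ (hx ‹_›)
    | left_absorb a x _ hx => rw [star_mul]; exact TwoSidedIdeal.mul_mem_right _ _ _ (hx ‹_›)
    | right_absorb b x _ hx => rw [star_mul]; exact TwoSidedIdeal.mul_mem_left _ _ _ (hx ‹_›)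

/-- A unital `*`-homomorphism respecting the relations `r` kills the `*`-ideal they generate. -/
theorem eq_zero_of_mem_starIdeal {B : Type*} [Ring B] [StarRing B] [Algebra ℂ A] [Algebra ℂ B]
    {r : A → A → Prop} (f : A →⋆ₐ[ℂ] B) (hf : ∀ a b, r a b → f a = f b) (a : A)
    (ha : a ∈ starIdeal r) : f a = 0 := by
  have h : TwoSidedIdeal.span {c : A | ∃ a b, r a b ∧ (c = a - b ∨ c = star (a - b))}
      ≤ TwoSidedIdeal.ker (f : A →+* B) := by
    rw [TwoSidedIdeal.span_le]
    rintro c ⟨a, b, hr, rfl | rfl⟩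
    · simp [TwoSidedIdeal.mem_ker, hf a b hr]
    · simp [TwoSidedIdeal.mem_ker, hf a b hr, map_star]
  exact (TwoSidedIdeal.mem_ker _).1 (h ha)

/-- Descent of a unital `*`-homomorphism to the quotient by the `*`-ideal generated by `r`. -/
def starLift {B : Type*} [Ring B] [StarRing B] [Algebra ℂ A] [Algebra ℂ B]
    {r : A → A → Prop} (f : A →⋆ₐ[ℂ] B) (hf : ∀ a b, r a b → f a = f b) :
    A ⧸ starIdeal r →⋆ₐ[ℂ] B :=
  { Ideal.Quotient.liftₐ (starIdeal r) f.toAlgHom (eq_zero_of_mem_starIdeal f hf) with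
    map_star' := by
      intro x
      obtain ⟨a, rfl⟩ := Ideal.Quotient.mk_surjective x
      exact map_star f a }

@[simp] theorem starLift_mk {B : Type*} [Ring B] [StarRing B] [Algebra ℂ A] [Algebra ℂ B]
    {r : A → A → Prop} (f : A →⋆ₐ[ℂ] B) (hf : ∀ a b, r a b → f a = f b) (a : A) :
    starLift f hf (Ideal.Quotient.mk _ a) = f a := rfl

end StarIdeal

/-! ## The free unital `*`-algebra -/

section Free

/-- The free unital complex `*`-algebra on a set `G`: noncommutative polynomials in the symbols
`g` (`Sum.inl g`) and `g*` (`Sum.inr g`). -/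
def FreeStar (G : Type*) : Type _ := FreeAlgebra ℂ (G ⊕ G)

variable {G : Type*}

instance : Ring (FreeStar G) := inferInstanceAs (Ring (FreeAlgebra ℂ (G ⊕ G)))
instance : Algebra ℂ (FreeStar G) := inferInstanceAs (Algebra ℂ (FreeAlgebra ℂ (G ⊕ G)))

/-- The symbol `g` (for `Sum.inl g`) or `g*` (for `Sum.inr g`) in the free `*`-algebra. -/
def FreeStar.sym (s : G ⊕ G) : FreeStar G := FreeAlgebra.ι ℂ s

/-- The generator `g` of the free `*`-algebra. -/
def FreeStar.of (g : G) : FreeStar G := FreeStar.sym (Sum.inl g)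

/-- The conjugate algebra structure on `A`, in which `c` acts as its complex conjugate. -/
abbrev conjAlgebra (A : Type*) [Ring A] [Algebra ℂ A] : Algebra ℂ A :=
  RingHom.toAlgebra' ((algebraMap ℂ A).comp (starRingEnd ℂ))
    (fun c x => Algebra.commutes (starRingEnd ℂ c) x)

/-- The ring homomorphism underlying the involution of the free `*`-algebra: it conjugates
scalars, reverses products, and exchanges `g` and `g*`. -/
def FreeStar.starHom : FreeStar G →+* (FreeStar G)ᵐᵒᵖ :=
  letI := conjAlgebra (FreeStar G)ᵐᵒᵖ
  (FreeAlgebra.lift (A := (FreeStar G)ᵐᵒᵖ) ℂ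
    (fun s : G ⊕ G => MulOpposite.op (FreeStar.sym s.swap))).toRingHom

theorem FreeStar.starHom_sym (s : G ⊕ G) :
    FreeStar.starHom (G := G) (FreeStar.sym s) =
      MulOpposite.op (FreeStar.sym s.swap) := by
  let _ := conjAlgebra (FreeStar G)ᵐᵒᵖ
  exact FreeAlgebra.lift_ι_apply (A := (FreeStar G)ᵐᵒᵖ) _ s

theorem FreeStar.starHom_algebraMap (c : ℂ) :
    FreeStar.starHom (G := G) (algebraMap ℂ (FreeStar G) c) =
      MulOpposite.op (algebraMap ℂ (FreeStar G) (star c)) := by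
  let _ := conjAlgebra (FreeStar G)ᵐᵒᵖ
  exact (FreeAlgebra.lift (A := (FreeStar G)ᵐᵒᵖ) ℂ
    (fun s : G ⊕ G => MulOpposite.op (FreeStar.sym s.swap))).commutes c

theorem FreeStar.induction {C : FreeStar G → Prop}
    (scalar : ∀ c : ℂ, C (algebraMap ℂ (FreeStar G) c))
    (gen : ∀ s : G ⊕ G, C (FreeStar.sym s))
    (mul : ∀ a b, C a → C b → C (a * b)) (add : ∀ a b, C a → C b → C (a + b))
    (a : FreeStar G) : C a :=
  FreeAlgebra.induction ℂ (G ⊕ G) (motive := C) scalar gen mul add a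

instance : StarRing (FreeStar G) where
  star a := (FreeStar.starHom a).unop
  star_involutive a := by
    change (FreeStar.starHom (FreeStar.starHom a).unop).unop = a
    induction a using FreeStar.induction with
    | scalar c => simp [FreeStar.starHom_algebraMap]
    | gen s => rw [FreeStar.starHom_sym, MulOpposite.unop_op, FreeStar.starHom_sym]; simp
    | mul a b ha hb => rw [map_mul, MulOpposite.unop_mul, map_mul, MulOpposite.unop_mul, ha, hb]
    | add a b ha hb => rw [map_add, MulOpposite.unop_add, map_add, MulOpposite.unop_add, ha, hb]
  star_mul a b := by
    change (FreeStar.starHom (a * b)).unop = _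
    rw [map_mul, MulOpposite.unop_mul]
  star_add a b := by
    change (FreeStar.starHom (a + b)).unop = _
    rw [map_add, MulOpposite.unop_add]

instance : StarModule ℂ (FreeStar G) where
  star_smul c a := by
    change (FreeStar.starHom (c • a)).unop = star c • (FreeStar.starHom a).unop
    rw [Algebra.smul_def, map_mul, FreeStar.starHom_algebraMap, MulOpposite.unop_mul,
      MulOpposite.unop_op, Algebra.smul_def, Algebra.commutes]

/-- The unital `*`-homomorphism on the free `*`-algebra with prescribed values on generators. -/
def FreeStar.lift {B : Type*} [Ring B] [StarRing B] [Algebra ℂ B] [StarModule ℂ B]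
    (f : G → B) : FreeStar G →⋆ₐ[ℂ] B :=
  { (FreeAlgebra.lift ℂ (Sum.elim f (fun g => star (f g))) : FreeAlgebra ℂ (G ⊕ G) →ₐ[ℂ] B) with
    map_star' := by
      intro a
      set F : FreeStar G →ₐ[ℂ] B :=
        (FreeAlgebra.lift ℂ (Sum.elim f (fun g => star (f g))) : FreeAlgebra ℂ (G ⊕ G) →ₐ[ℂ] B)
      have hF : ∀ s : G ⊕ G, F (FreeStar.sym s) =
        Sum.elim f (fun g => star (f g)) s := fun s => FreeAlgebra.lift_ι_apply _ s
      change F (FreeStar.starHom a).unop = star (F a)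
      induction a using FreeStar.induction with
      | scalar c =>
        rw [FreeStar.starHom_algebraMap, MulOpposite.unop_op, F.commutes, F.commutes,
          algebraMap_star_comm]
      | gen s =>
        rw [FreeStar.starHom_sym, MulOpposite.unop_op, hF, hF]
        cases s <;> simp
      | mul a b ha hb => rw [map_mul, MulOpposite.unop_mul, map_mul, map_mul, ha, hb, star_mul]
      | add a b ha hb => rw [map_add, MulOpposite.unop_add, map_add, map_add, ha, hb, star_add] }

@[simp] theorem FreeStar.lift_of {B : Type*} [Ring B] [StarRing B] [Algebra ℂ B] [StarModule ℂ B]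
    (f : G → B) (g : G) : FreeStar.lift f (FreeStar.of g) = f g :=
  FreeAlgebra.lift_ι_apply (A := B) _ (Sum.inl g)

theorem FreeStar.star_of (g : G) :
    star (FreeStar.of g) = FreeStar.sym (Sum.inr g) := by
  change (FreeStar.starHom _).unop = _
  rw [FreeStar.of, FreeStar.starHom_sym]; rfl

/-- Two unital homomorphisms on the free `*`-algebra agree if they agree on all `g` and `g*`. -/
theorem FreeStar.algHom_ext {B : Type*} [Ring B] [Algebra ℂ B] {f f' : FreeStar G →ₐ[ℂ] B}
    (h : ∀ g, f (FreeStar.of g) = f' (FreeStar.of g))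
    (h' : ∀ g, f (star (FreeStar.of g)) = f' (star (FreeStar.of g))) : f = f' := by
  refine FreeAlgebra.hom_ext (A := B) (f := f) (g := f') (funext fun s => ?_)
  cases s with
  | inl g => exact h g
  | inr g => have := h' g; rw [FreeStar.star_of] at this; exact this

end Free

/-! ## Hypergraphs and quantum isomorphism spaces -/

set_option linter.unusedSectionVars false

section Magic

variable {I J K A B : Type*} [Fintype I] [Fintype J] [Fintype K]
  [Ring A] [StarRing A] [Algebra ℂ A] [Ring B] [StarRing B] [Algebra ℂ B]

/-- The defining relations of a magic unitary (quantum permutation matrix): selfadjoint idempotent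
entries, rows and columns summing to `1`, and orthogonality within rows and columns. -/
inductive MagicRel (u : Matrix I J A) : A → A → Prop
  | star_eq (i : I) (j : J) : MagicRel u (star (u i j)) (u i j)
  | idem (i : I) (j : J) : MagicRel u (u i j * u i j) (u i j)
  | row_sum (i : I) : MagicRel u (∑ j, u i j) 1
  | col_sum (j : J) : MagicRel u (∑ i, u i j) 1
  | row_orth (i : I) (j j' : J) (h : j ≠ j') : MagicRel u (u i j * u i j') 0
  | col_orth (j : J) (i i' : I) (h : i ≠ i') : MagicRel u (u i j * u i' j) 0

/-- `u` is a magic unitary. -/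
def IsMagicUnitary (u : Matrix I J A) : Prop := ∀ a b, MagicRel u a b → a = b

theorem MagicRel.map {u : Matrix I J A} {a b : A} (h : MagicRel u a b) (f : A →⋆ₐ[ℂ] B) :
    MagicRel (u.map f) (f a) (f b) := by
  cases h with
  | star_eq i j => rw [map_star]; exact .star_eq (u := u.map f) i j
  | idem i j => rw [map_mul]; exact .idem (u := u.map f) i j
  | row_sum i => rw [map_sum, map_one]; exact .row_sum (u := u.map f) i
  | col_sum i => rw [map_sum, map_one]; exact .col_sum (u := u.map f) i
  | row_orth i j j' h => rw [map_mul, map_zero]; exact .row_orth (u := u.map f) i j j' h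
  | col_orth j i i' h => rw [map_mul, map_zero]; exact .col_orth (u := u.map f) j i i' h

open Classical in
theorem IsMagicUnitary.row_mul {u : Matrix I J A} (hu : IsMagicUnitary u) (i : I) (j j' : J) :
    u i j * u i j' = if j = j' then u i j else 0 := by
  split_ifs with h
  · subst h; exact hu _ _ (.idem i j)
  · exact hu _ _ (.row_orth i j j' h)

open Classical in
theorem IsMagicUnitary.col_mul {u : Matrix I J A} (hu : IsMagicUnitary u) (j : J) (i i' : I) :
    u i j * u i' j = if i = i' then u i j else 0 := by
  split_ifs with h
  · subst h; exact hu _ _ (.idem i j)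
  · exact hu _ _ (.col_orth j i i' h)

open Classical in
theorem IsMagicUnitary.sum_row_mul {u : Matrix I J A} (hu : IsMagicUnitary u) (j j' : J) :
    ∑ i, u i j * u i j' = algebraMap ℂ A (if j = j' then 1 else 0) := by
  simp only [hu.row_mul]
  split_ifs with h
  · rw [hu _ _ (.col_sum j), map_one]
  · rw [Finset.sum_const_zero, map_zero]

open Classical in
theorem IsMagicUnitary.sum_col_mul {u : Matrix I J A} (hu : IsMagicUnitary u) (i i' : I) :
    ∑ j, u i j * u i' j = algebraMap ℂ A (if i = i' then 1 else 0) := by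
  simp only [hu.col_mul]
  split_ifs with h
  · rw [hu _ _ (.row_sum i), map_one]
  · rw [Finset.sum_const_zero, map_zero]

/-- The product matrix `(∑ j, u i j ⊗ w j k)`. -/
def tensorMul (u : Matrix I J A) (w : Matrix J K B) : Matrix I K (A ⊗[ℂ] B) :=
  fun i k => ∑ j, u i j ⊗ₜ[ℂ] w j k

theorem IsMagicUnitary.tensorMul [StarModule ℂ A] [StarModule ℂ B]
    {u : Matrix I J A} {w : Matrix J K B} (hu : IsMagicUnitary u)
    (hw : IsMagicUnitary w) : IsMagicUnitary (tensorMul u w) := by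
  classical
  intro a b h
  cases h with
  | star_eq i k =>
    simp only [QIso.tensorMul, star_sum, TensorProduct.star_tmul]
    exact Finset.sum_congr rfl fun j _ => by rw [hu _ _ (.star_eq i j), hw _ _ (.star_eq j k)]
  | idem i k =>
    simp only [QIso.tensorMul, Finset.sum_mul_sum, Algebra.TensorProduct.tmul_mul_tmul,
      hu.row_mul]
    refine Finset.sum_congr rfl fun j _ => ?_
    rw [Finset.sum_eq_single j]
    · rw [if_pos rfl, hw _ _ (.idem j k)]
    · intro j' _ h; rw [if_neg h.symm, TensorProduct.zero_tmul]
    · simp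
  | row_sum i =>
    simp only [QIso.tensorMul]
    rw [Finset.sum_comm]
    simp only [← TensorProduct.tmul_sum, hw _ _ (.row_sum _)]
    rw [← TensorProduct.sum_tmul, hu _ _ (.row_sum i), Algebra.TensorProduct.one_def]
  | col_sum k =>
    simp only [QIso.tensorMul]
    rw [Finset.sum_comm]
    simp only [← TensorProduct.sum_tmul, hu _ _ (.col_sum _)]
    rw [← TensorProduct.tmul_sum, hw _ _ (.col_sum k), Algebra.TensorProduct.one_def]
  | row_orth i k k' hk =>
    simp only [QIso.tensorMul, Finset.sum_mul_sum, Algebra.TensorProduct.tmul_mul_tmul,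
      hu.row_mul]
    refine Finset.sum_eq_zero fun j _ => Finset.sum_eq_zero fun j' _ => ?_
    by_cases h : j = j'
    · subst h; rw [hw _ _ (.row_orth j k k' hk), TensorProduct.tmul_zero]
    · rw [if_neg h, TensorProduct.zero_tmul]
  | col_orth k i i' hi =>
    simp only [QIso.tensorMul, Finset.sum_mul_sum, Algebra.TensorProduct.tmul_mul_tmul,
      hw.col_mul]
    refine Finset.sum_eq_zero fun j _ => Finset.sum_eq_zero fun j' _ => ?_
    by_cases h : j = j'
    · subst h; rw [hu _ _ (.col_orth j i i' hi), TensorProduct.zero_tmul]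
    · rw [if_neg h, TensorProduct.tmul_zero]

theorem IsMagicUnitary.transpose_op {u : Matrix I J A} (hu : IsMagicUnitary u) :
    IsMagicUnitary (fun j i => MulOpposite.op (u i j)) := by
  intro a b r
  cases r with
  | star_eq i j => rw [← MulOpposite.op_star, hu _ _ (.star_eq j i)]
  | idem i j => rw [← MulOpposite.op_mul, hu _ _ (.idem j i)]
  | row_sum i => rw [← Finset.op_sum, hu _ _ (.col_sum i), MulOpposite.op_one]
  | col_sum j => rw [← Finset.op_sum, hu _ _ (.row_sum j), MulOpposite.op_one]
  | row_orth i j j' hj =>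
    rw [← MulOpposite.op_mul, hu _ _ (.col_orth i j' j hj.symm), MulOpposite.op_zero]
  | col_orth j i i' hi =>
    rw [← MulOpposite.op_mul, hu _ _ (.row_orth j i' i hi.symm), MulOpposite.op_zero]

end Magic

/-- A hypergraph with vertex set `V` and (labelled) edge set `E`, given by its incidence relation
`Λ ⊆ V × E`. -/
abbrev Hypergraph (V E : Type*) := Set (V × E)

open Classical in
/-- The incidence matrix of a hypergraph. -/
def incidence {V E : Type*} (Λ : Hypergraph V E) : Matrix V E ℂ :=
  fun v e => if (v, e) ∈ Λ then 1 else 0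

section IsoRel

variable {V₁ E₁ V₂ E₂ V₃ E₃ A B : Type*} [Fintype V₁] [Fintype E₁] [Fintype V₂] [Fintype E₂]
  [Fintype V₃] [Fintype E₃]
  [Ring A] [StarRing A] [Algebra ℂ A] [Ring B] [StarRing B] [Algebra ℂ B]
  {Λ₁ : Hypergraph V₁ E₁} {Λ₂ : Hypergraph V₂ E₂} {Λ₃ : Hypergraph V₃ E₃}

/-- The defining relations of a quantum isomorphism `(P, Q)` between two hypergraphs: `P` and `Q`
are magic unitaries, and `A_{Λ₁} Q = P A_{Λ₂}` (entry by entry). -/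
inductive IsoRel (Λ₁ : Hypergraph V₁ E₁) (Λ₂ : Hypergraph V₂ E₂)
    (P : Matrix V₁ V₂ A) (Q : Matrix E₁ E₂ A) : A → A → Prop
  | vertex {a b : A} (h : MagicRel P a b) : IsoRel Λ₁ Λ₂ P Q a b
  | edge {a b : A} (h : MagicRel Q a b) : IsoRel Λ₁ Λ₂ P Q a b
  | intertwine (v : V₁) (f : E₂) :
      IsoRel Λ₁ Λ₂ P Q (∑ e, incidence Λ₁ v e • Q e f) (∑ w, incidence Λ₂ w f • P v w)

/-- `(P, Q)` is a quantum isomorphism between the hypergraphs `Λ₁` and `Λ₂`. -/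
def IsQuantumIso (Λ₁ : Hypergraph V₁ E₁) (Λ₂ : Hypergraph V₂ E₂)
    (P : Matrix V₁ V₂ A) (Q : Matrix E₁ E₂ A) : Prop :=
  ∀ a b, IsoRel Λ₁ Λ₂ P Q a b → a = b

theorem IsoRel.map {P : Matrix V₁ V₂ A} {Q : Matrix E₁ E₂ A} {a b : A}
    (h : IsoRel Λ₁ Λ₂ P Q a b) (f : A →⋆ₐ[ℂ] B) :
    IsoRel Λ₁ Λ₂ (P.map f) (Q.map f) (f a) (f b) := by
  cases h with
  | vertex h => exact .vertex (h.map f)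
  | edge h => exact .edge (h.map f)
  | intertwine v e =>
    simp only [map_sum, map_smul]
    exact .intertwine (P := P.map f) (Q := Q.map f) v e

theorem IsQuantumIso.magic_vertex {P : Matrix V₁ V₂ A} {Q : Matrix E₁ E₂ A}
    (h : IsQuantumIso Λ₁ Λ₂ P Q) : IsMagicUnitary P := fun _ _ r => h _ _ (.vertex r)

theorem IsQuantumIso.magic_edge {P : Matrix V₁ V₂ A} {Q : Matrix E₁ E₂ A}
    (h : IsQuantumIso Λ₁ Λ₂ P Q) : IsMagicUnitary Q := fun _ _ r => h _ _ (.edge r)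

theorem IsQuantumIso.tensorMul [StarModule ℂ A] [StarModule ℂ B]
    {P : Matrix V₁ V₂ A} {Q : Matrix E₁ E₂ A} {P' : Matrix V₂ V₃ B}
    {Q' : Matrix E₂ E₃ B} (h : IsQuantumIso Λ₁ Λ₂ P Q) (h' : IsQuantumIso Λ₂ Λ₃ P' Q') :
    IsQuantumIso Λ₁ Λ₃ (tensorMul P P') (tensorMul Q Q') := by
  intro a b r
  cases r with
  | vertex r => exact h.magic_vertex.tensorMul h'.magic_vertex _ _ r
  | edge r => exact h.magic_edge.tensorMul h'.magic_edge _ _ r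
  | intertwine v f =>
    simp only [QIso.tensorMul, Finset.smul_sum]
    rw [Finset.sum_comm, Finset.sum_comm (s := (Finset.univ : Finset V₃))]
    simp only [← TensorProduct.tmul_smul, ← TensorProduct.tmul_sum]
    simp only [← h' _ _ (.intertwine _ f), TensorProduct.tmul_sum]
    rw [Finset.sum_comm (s := (Finset.univ : Finset V₂))]
    refine Finset.sum_congr rfl fun g _ => ?_
    simp only [TensorProduct.tmul_smul, TensorProduct.smul_tmul', ← TensorProduct.sum_tmul]
    rw [h _ _ (.intertwine v g)]

/-- Transposing and reversing the product turns a quantum isomorphism from `Λ₂` to `Λ₁` into one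
from `Λ₁` to `Λ₂`. -/
theorem IsQuantumIso.transpose_op {P : Matrix V₂ V₁ A} {Q : Matrix E₂ E₁ A}
    (h : IsQuantumIso Λ₂ Λ₁ P Q) :
    IsQuantumIso Λ₁ Λ₂ (fun v w => MulOpposite.op (P w v)) (fun e f => MulOpposite.op (Q f e)) := by
  intro a b r
  cases r with
  | vertex r => exact h.magic_vertex.transpose_op _ _ r
  | edge r => exact h.magic_edge.transpose_op _ _ r
  | intertwine v f =>
    classical
    simp only [← MulOpposite.op_smul, ← Finset.op_sum]
    congr 1
    have hP := h.magic_vertex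
    have hQ := h.magic_edge
    have key : ∀ e : E₁, incidence Λ₁ v e • (1 : A) =
        ∑ w, ∑ g, incidence Λ₂ w g • (P w v * Q g e) := by
      intro e
      have : ∀ w, ∑ g, incidence Λ₂ w g • (P w v * Q g e) =
          ∑ x, incidence Λ₁ x e • (P w v * P w x) := by
        intro w
        have := congrArg (fun t => P w v * t) (h _ _ (.intertwine w e))
        simpa only [Finset.mul_sum, mul_smul_comm] using this
      simp only [this, hP.row_mul]
      rw [Finset.sum_comm]
      rw [Finset.sum_eq_single v]
      · simp only [if_true, ← Finset.smul_sum]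
        rw [hP _ _ (.col_sum v)]
      · intro x _ hx
        simp [Ne.symm hx]
      · simp
    calc ∑ e, incidence Λ₁ v e • Q f e
        = ∑ e, (incidence Λ₁ v e • (1 : A)) * Q f e := by simp
      _ = ∑ e, ∑ w, ∑ g, incidence Λ₂ w g • (P w v * (Q g e * Q f e)) := by
          simp only [key, Finset.sum_mul, smul_mul_assoc, mul_assoc]
      _ = ∑ e, ∑ w, incidence Λ₂ w f • (P w v * Q f e) := by
          refine Finset.sum_congr rfl fun e _ => Finset.sum_congr rfl fun w _ => ?_
          rw [Finset.sum_eq_single f]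
          · rw [hQ _ _ (.idem f e)]
          · intro g _ hg; rw [hQ _ _ (.col_orth e g f hg), mul_zero, smul_zero]
          · simp
      _ = ∑ w, incidence Λ₂ w f • P w v := by
          rw [Finset.sum_comm]
          simp only [← Finset.smul_sum, ← Finset.mul_sum, hQ _ _ (.row_sum f), mul_one]

end IsoRel

section Space

variable {V₁ E₁ V₂ E₂ V₃ E₃ : Type*} [Fintype V₁] [Fintype E₁] [Fintype V₂] [Fintype E₂]
  [Fintype V₃] [Fintype E₃]

/-- The generators `p_{v,w}` and `p_{e,f}` in the free `*`-algebra. -/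
abbrev FreeGen (V₁ E₁ V₂ E₂ : Type*) : Type _ := FreeStar ((V₁ × V₂) ⊕ (E₁ × E₂))

/-- The relations imposed on the free `*`-algebra to obtain the quantum isomorphism space. -/
abbrev genRel (Λ₁ : Hypergraph V₁ E₁) (Λ₂ : Hypergraph V₂ E₂) :
    FreeGen V₁ E₁ V₂ E₂ → FreeGen V₁ E₁ V₂ E₂ → Prop :=
  IsoRel Λ₁ Λ₂ (fun v w => FreeStar.of (Sum.inl (v, w))) (fun e f => FreeStar.of (Sum.inr (e, f)))

/-- The quantum isomorphism space `O(Λ₁, Λ₂)`: the universal unital `*`-algebra generated by the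
entries of two magic unitaries `P_V = (p_{v,w})` and `P_E = (p_{e,f})` such that
`A_{Λ₁} P_E = P_V A_{Λ₂}`. -/
def IsoSpace (Λ₁ : Hypergraph V₁ E₁) (Λ₂ : Hypergraph V₂ E₂) : Type _ :=
  FreeGen V₁ E₁ V₂ E₂ ⧸ starIdeal (genRel Λ₁ Λ₂)

variable (Λ₁ : Hypergraph V₁ E₁) (Λ₂ : Hypergraph V₂ E₂) (Λ₃ : Hypergraph V₃ E₃)

instance : Ring (IsoSpace Λ₁ Λ₂) :=
  inferInstanceAs (Ring (FreeGen V₁ E₁ V₂ E₂ ⧸ starIdeal (genRel Λ₁ Λ₂)))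
instance : StarRing (IsoSpace Λ₁ Λ₂) :=
  inferInstanceAs (StarRing (FreeGen V₁ E₁ V₂ E₂ ⧸ starIdeal (genRel Λ₁ Λ₂)))
instance isoAlgebra : Algebra ℂ (IsoSpace Λ₁ Λ₂) :=
  inferInstanceAs (Algebra ℂ (FreeGen V₁ E₁ V₂ E₂ ⧸ starIdeal (genRel Λ₁ Λ₂)))
instance : StarModule ℂ (IsoSpace Λ₁ Λ₂) :=
  inferInstanceAs (StarModule ℂ (FreeGen V₁ E₁ V₂ E₂ ⧸ starIdeal (genRel Λ₁ Λ₂)))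

/-- The canonical map from the free `*`-algebra. -/
def IsoSpace.mk : FreeGen V₁ E₁ V₂ E₂ →⋆ₐ[ℂ] IsoSpace Λ₁ Λ₂ := quotientMap (starIdeal (genRel Λ₁ Λ₂))

/-- The vertex magic unitary `P_V` of `O(Λ₁, Λ₂)`. -/
def IsoSpace.vertex : Matrix V₁ V₂ (IsoSpace Λ₁ Λ₂) := fun v w => IsoSpace.mk Λ₁ Λ₂ (FreeStar.of (Sum.inl (v, w)))

/-- The edge magic unitary `P_E` of `O(Λ₁, Λ₂)`. -/
def IsoSpace.edge : Matrix E₁ E₂ (IsoSpace Λ₁ Λ₂) := fun e f => IsoSpace.mk Λ₁ Λ₂ (FreeStar.of (Sum.inr (e, f)))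

theorem IsoSpace.isQuantumIso : IsQuantumIso Λ₁ Λ₂ (IsoSpace.vertex Λ₁ Λ₂) (IsoSpace.edge Λ₁ Λ₂) := by
  have key : ∀ a b, genRel Λ₁ Λ₂ a b → IsoSpace.mk Λ₁ Λ₂ a = IsoSpace.mk Λ₁ Λ₂ b := fun a b h =>
    Ideal.Quotient.eq.2 (sub_mem_starIdeal h)
  intro a b h
  cases h with
  | vertex h =>
    cases h with
    | star_eq i j => exact (map_star _ _).symm.trans (key _ _ (.vertex (.star_eq i j)))
    | idem i j => exact (map_mul _ _ _).symm.trans (key _ _ (.vertex (.idem i j)))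
    | row_sum i =>
      exact (map_sum _ _ _).symm.trans ((key _ _ (.vertex (.row_sum i))).trans (map_one _))
    | col_sum j =>
      exact (map_sum _ _ _).symm.trans ((key _ _ (.vertex (.col_sum j))).trans (map_one _))
    | row_orth i j j' h =>
      exact (map_mul _ _ _).symm.trans ((key _ _ (.vertex (.row_orth i j j' h))).trans (map_zero _))
    | col_orth j i i' h =>
      exact (map_mul _ _ _).symm.trans ((key _ _ (.vertex (.col_orth j i i' h))).trans (map_zero _))
  | edge h =>
    cases h with
    | star_eq i j => exact (map_star _ _).symm.trans (key _ _ (.edge (.star_eq i j)))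
    | idem i j => exact (map_mul _ _ _).symm.trans (key _ _ (.edge (.idem i j)))
    | row_sum i =>
      exact (map_sum _ _ _).symm.trans ((key _ _ (.edge (.row_sum i))).trans (map_one _))
    | col_sum j =>
      exact (map_sum _ _ _).symm.trans ((key _ _ (.edge (.col_sum j))).trans (map_one _))
    | row_orth i j j' h =>
      exact (map_mul _ _ _).symm.trans ((key _ _ (.edge (.row_orth i j j' h))).trans (map_zero _))
    | col_orth j i i' h =>
      exact (map_mul _ _ _).symm.trans ((key _ _ (.edge (.col_orth j i i' h))).trans (map_zero _))
  | intertwine v f =>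
    have := key _ _ (.intertwine v f)
    simp only [map_sum, map_smul] at this
    exact this

variable {Λ₁ Λ₂ Λ₃}

/-- The universal property: a quantum isomorphism `(P, Q)` with entries in a unital `*`-algebra
`A` induces a unital `*`-homomorphism `O(Λ₁, Λ₂) → A`. -/
def IsoSpace.lift {A : Type*} [Ring A] [StarRing A] [Algebra ℂ A] [StarModule ℂ A]
    {P : Matrix V₁ V₂ A} {Q : Matrix E₁ E₂ A} (h : IsQuantumIso Λ₁ Λ₂ P Q) : IsoSpace Λ₁ Λ₂ →⋆ₐ[ℂ] A :=
  starLift (FreeStar.lift (Sum.elim (fun x => P x.1 x.2) (fun x => Q x.1 x.2)))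
    (fun a b r => by
      refine h _ _ ?_
      have hP : (Matrix.map (fun v w => FreeStar.of (Sum.inl (v, w)))
          (FreeStar.lift
            (Sum.elim (fun x : V₁ × V₂ => P x.1 x.2) (fun x : E₁ × E₂ => Q x.1 x.2))) :
            Matrix V₁ V₂ A) = P := by
        funext v w; exact FreeStar.lift_of _ _
      have hQ : (Matrix.map (fun v w => FreeStar.of (Sum.inr (v, w)))
          (FreeStar.lift
            (Sum.elim (fun x : V₁ × V₂ => P x.1 x.2) (fun x : E₁ × E₂ => Q x.1 x.2))) :
            Matrix E₁ E₂ A) = Q := by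
        funext v w; exact FreeStar.lift_of _ _
      have := r.map (FreeStar.lift
        (Sum.elim (fun x : V₁ × V₂ => P x.1 x.2) (fun x : E₁ × E₂ => Q x.1 x.2)))
      rw [hP, hQ] at this
      exact this)

@[simp] theorem IsoSpace.lift_vertex {A : Type*} [Ring A] [StarRing A] [Algebra ℂ A] [StarModule ℂ A]
    {P : Matrix V₁ V₂ A} {Q : Matrix E₁ E₂ A} (h : IsQuantumIso Λ₁ Λ₂ P Q) (v : V₁) (w : V₂) :
    IsoSpace.lift h (IsoSpace.vertex Λ₁ Λ₂ v w) = P v w :=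
  FreeStar.lift_of (Sum.elim (fun x : V₁ × V₂ => P x.1 x.2) (fun x : E₁ × E₂ => Q x.1 x.2)) (Sum.inl (v, w))

@[simp] theorem IsoSpace.lift_edge {A : Type*} [Ring A] [StarRing A] [Algebra ℂ A] [StarModule ℂ A]
    {P : Matrix V₁ V₂ A} {Q : Matrix E₁ E₂ A} (h : IsQuantumIso Λ₁ Λ₂ P Q) (e : E₁) (f : E₂) :
    IsoSpace.lift h (IsoSpace.edge Λ₁ Λ₂ e f) = Q e f :=
  FreeStar.lift_of (Sum.elim (fun x : V₁ × V₂ => P x.1 x.2) (fun x : E₁ × E₂ => Q x.1 x.2)) (Sum.inr (e, f))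

/-- Unital homomorphisms on `O(Λ₁, Λ₂)` are determined by their values on the generators. -/
theorem IsoSpace.algHom_ext {B : Type*} [Ring B] [Algebra ℂ B] {f f' : IsoSpace Λ₁ Λ₂ →ₐ[ℂ] B}
    (hv : ∀ v w, f (IsoSpace.vertex Λ₁ Λ₂ v w) = f' (IsoSpace.vertex Λ₁ Λ₂ v w))
    (he : ∀ v w, f (IsoSpace.edge Λ₁ Λ₂ v w) = f' (IsoSpace.edge Λ₁ Λ₂ v w)) : f = f' := by
  have h : f.comp (IsoSpace.mk Λ₁ Λ₂).toAlgHom = f'.comp (IsoSpace.mk Λ₁ Λ₂).toAlgHom := by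
    refine FreeStar.algHom_ext (fun g => ?_) (fun g => ?_)
    · rcases g with ⟨v, w⟩ | ⟨v, w⟩
      · exact hv v w
      · exact he v w
    · change f (IsoSpace.mk Λ₁ Λ₂ (star _)) = f' (IsoSpace.mk Λ₁ Λ₂ (star _))
      rw [map_star]
      rcases g with ⟨v, w⟩ | ⟨v, w⟩
      · rw [show star (IsoSpace.mk Λ₁ Λ₂ (FreeStar.of (Sum.inl (v, w)))) = IsoSpace.vertex Λ₁ Λ₂ v w from
          IsoSpace.isQuantumIso Λ₁ Λ₂ _ _ (.vertex (.star_eq v w))]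
        exact hv v w
      · rw [show star (IsoSpace.mk Λ₁ Λ₂ (FreeStar.of (Sum.inr (v, w)))) = IsoSpace.edge Λ₁ Λ₂ v w from
          IsoSpace.isQuantumIso Λ₁ Λ₂ _ _ (.edge (.star_eq v w))]
        exact he v w
  refine AlgHom.ext fun x => ?_
  obtain ⟨a, rfl⟩ := Ideal.Quotient.mk_surjective x
  exact DFunLike.congr_fun h a

/-- A subset of `O(Λ₁, Λ₂)` closed under sums and products and containing the scalars and the
generators is everything. -/
theorem IsoSpace.induction {C : IsoSpace Λ₁ Λ₂ → Prop}
    (scalar : ∀ c : ℂ, C (algebraMap ℂ (IsoSpace Λ₁ Λ₂) c))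
    (vertex : ∀ v w, C (IsoSpace.vertex Λ₁ Λ₂ v w)) (edge : ∀ v w, C (IsoSpace.edge Λ₁ Λ₂ v w))
    (mul : ∀ a b, C a → C b → C (a * b)) (add : ∀ a b, C a → C b → C (a + b))
    (x : IsoSpace Λ₁ Λ₂) : C x := by
  obtain ⟨a, rfl⟩ := Ideal.Quotient.mk_surjective x
  change C (IsoSpace.mk Λ₁ Λ₂ a)
  induction a using FreeStar.induction with
  | scalar c => rw [AlgHomClass.commutes]; exact scalar c
  | gen s =>
    rcases s with (⟨v, w⟩ | ⟨v, w⟩) | (⟨v, w⟩ | ⟨v, w⟩)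
    · exact vertex v w
    · exact edge v w
    · rw [← FreeStar.star_of, map_star]
      rw [show star (IsoSpace.mk Λ₁ Λ₂ (FreeStar.of (Sum.inl (v, w)))) = IsoSpace.vertex Λ₁ Λ₂ v w from
          IsoSpace.isQuantumIso Λ₁ Λ₂ _ _ (.vertex (.star_eq v w))]
      exact vertex v w
    · rw [← FreeStar.star_of, map_star]
      rw [show star (IsoSpace.mk Λ₁ Λ₂ (FreeStar.of (Sum.inr (v, w)))) = IsoSpace.edge Λ₁ Λ₂ v w from
          IsoSpace.isQuantumIso Λ₁ Λ₂ _ _ (.edge (.star_eq v w))]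
      exact edge v w
  | mul a b ha hb => rw [map_mul]; exact mul _ _ ha hb
  | add a b ha hb => rw [map_add]; exact add _ _ ha hb

variable (Λ₁ Λ₂ Λ₃)

/-- The unital `*`-homomorphism `O(Λ₁, Λ₃) → O(Λ₁, Λ₂) ⊗ O(Λ₂, Λ₃)` with
`p_{v,x} ↦ ∑ w, p_{v,w} ⊗ p_{w,x}` and `p_{e,g} ↦ ∑ f, p_{e,f} ⊗ p_{f,g}`. -/
def IsoSpace.comp : IsoSpace Λ₁ Λ₃ →⋆ₐ[ℂ] IsoSpace Λ₁ Λ₂ ⊗[ℂ] IsoSpace Λ₂ Λ₃ :=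
  IsoSpace.lift ((IsoSpace.isQuantumIso Λ₁ Λ₂).tensorMul (IsoSpace.isQuantumIso Λ₂ Λ₃))

theorem IsoSpace.comp_vertex (v : V₁) (x : V₃) : IsoSpace.comp Λ₁ Λ₂ Λ₃ (IsoSpace.vertex Λ₁ Λ₃ v x) =
    ∑ w, IsoSpace.vertex Λ₁ Λ₂ v w ⊗ₜ[ℂ] IsoSpace.vertex Λ₂ Λ₃ w x := IsoSpace.lift_vertex _ v x

theorem IsoSpace.comp_edge (e : E₁) (g : E₃) : IsoSpace.comp Λ₁ Λ₂ Λ₃ (IsoSpace.edge Λ₁ Λ₃ e g) =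
    ∑ f, IsoSpace.edge Λ₁ Λ₂ e f ⊗ₜ[ℂ] IsoSpace.edge Λ₂ Λ₃ f g := IsoSpace.lift_edge _ e g

/-- The unital `*`-homomorphism `O(Λ₁, Λ₂) → O(Λ₂, Λ₁)ᵒᵖ`, `p_{v,w} ↦ p_{w,v}`,
`p_{e,f} ↦ p_{f,e}`. -/
def IsoSpace.inv : IsoSpace Λ₁ Λ₂ →⋆ₐ[ℂ] (IsoSpace Λ₂ Λ₁)ᵐᵒᵖ := IsoSpace.lift (IsoSpace.isQuantumIso Λ₂ Λ₁).transpose_op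

theorem IsoSpace.inv_vertex (v : V₁) (w : V₂) :
    IsoSpace.inv Λ₁ Λ₂ (IsoSpace.vertex Λ₁ Λ₂ v w) = MulOpposite.op (IsoSpace.vertex Λ₂ Λ₁ w v) :=
  IsoSpace.lift_vertex _ v w

theorem IsoSpace.inv_edge (e : E₁) (f : E₂) :
    IsoSpace.inv Λ₁ Λ₂ (IsoSpace.edge Λ₁ Λ₂ e f) = MulOpposite.op (IsoSpace.edge Λ₂ Λ₁ f e) :=
  IsoSpace.lift_edge _ e f

end Space

/-! ## The Hopf `*`-algebra of quantum automorphisms of a hypergraph -/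

section Hopf

variable {V E : Type*} [Fintype V] [Fintype E] (Λ : Hypergraph V E)

open Classical in
theorem isMagicUnitary_one {I : Type*} [Fintype I] : IsMagicUnitary (1 : Matrix I I ℂ) := by
  intro a b r
  cases r with
  | star_eq i j => rw [Matrix.one_apply]; split_ifs <;> simp
  | idem i j => rw [Matrix.one_apply]; split_ifs <;> simp
  | row_sum i => simp [Matrix.one_apply]
  | col_sum j => simp [Matrix.one_apply]
  | row_orth i j j' h =>
    by_cases h1 : i = j
    · subst h1; simp [h]
    · simp [h1]
  | col_orth j i i' h =>
    by_cases h1 : i = j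
    · subst h1; simp [h.symm]
    · simp [h1]

open Classical in
theorem isQuantumIso_one : IsQuantumIso Λ Λ (1 : Matrix V V ℂ) (1 : Matrix E E ℂ) := by
  intro a b r
  cases r with
  | vertex r => exact isMagicUnitary_one _ _ r
  | edge r => exact isMagicUnitary_one _ _ r
  | intertwine v f => simp [Matrix.one_apply]

open Classical in
/-- The counit `O(Λ) → ℂ`, `u_{v,w} ↦ δ_{v,w}`, `u_{e,f} ↦ δ_{e,f}`. -/
def IsoSpace.counit : IsoSpace Λ Λ →⋆ₐ[ℂ] ℂ := IsoSpace.lift (isQuantumIso_one Λ)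

open Classical in
theorem IsoSpace.counit_vertex (v w : V) :
    IsoSpace.counit Λ (IsoSpace.vertex Λ Λ v w) = if v = w then 1 else 0 :=
  (IsoSpace.lift_vertex _ v w).trans (by simp [Matrix.one_apply])

open Classical in
theorem IsoSpace.counit_edge (e f : E) :
    IsoSpace.counit Λ (IsoSpace.edge Λ Λ e f) = if e = f then 1 else 0 :=
  (IsoSpace.lift_edge _ e f).trans (by simp [Matrix.one_apply])

/-- The bialgebra structure of `O(Λ) = O(Λ, Λ)`. -/
instance isoBialgebra : Bialgebra ℂ (IsoSpace Λ Λ) :=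
  Bialgebra.ofAlgHom (IsoSpace.comp Λ Λ Λ).toAlgHom (IsoSpace.counit Λ).toAlgHom
    (by
      refine IsoSpace.algHom_ext (fun v w => ?_) (fun v w => ?_)
      · have h := IsoSpace.comp_vertex Λ Λ Λ
        simp only [AlgHom.comp_apply, StarAlgHom.coe_toAlgHom, h, map_sum,
          Algebra.TensorProduct.map_tmul, TensorProduct.sum_tmul, TensorProduct.tmul_sum,
          AlgHom.coe_id, id_eq]
        rw [Finset.sum_comm]
        rfl
      · have h := IsoSpace.comp_edge Λ Λ Λ
        simp only [AlgHom.comp_apply, StarAlgHom.coe_toAlgHom, h, map_sum,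
          Algebra.TensorProduct.map_tmul, TensorProduct.sum_tmul, TensorProduct.tmul_sum,
          AlgHom.coe_id, id_eq]
        rw [Finset.sum_comm]
        rfl)
    (by
      refine IsoSpace.algHom_ext (fun v w => ?_) (fun v w => ?_)
      · have h := IsoSpace.comp_vertex Λ Λ Λ
        have h' := IsoSpace.counit_vertex Λ
        simp [h, h', TensorProduct.ite_tmul]
        rw [Finset.sum_eq_single v (fun x _ hx => if_neg hx.symm) (by simp), if_pos rfl]
      · have h := IsoSpace.comp_edge Λ Λ Λ
        have h' := IsoSpace.counit_edge Λ
        simp [h, h', TensorProduct.ite_tmul]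
        rw [Finset.sum_eq_single v (fun x _ hx => if_neg hx.symm) (by simp), if_pos rfl])
    (by
      refine IsoSpace.algHom_ext (fun v w => ?_) (fun v w => ?_)
      · have h := IsoSpace.comp_vertex Λ Λ Λ
        have h' := IsoSpace.counit_vertex Λ
        simp [h, h', TensorProduct.tmul_ite]
        rw [Finset.sum_eq_single w (fun x _ hx => if_neg hx) (by simp), if_pos rfl]
      · have h := IsoSpace.comp_edge Λ Λ Λ
        have h' := IsoSpace.counit_edge Λ
        simp [h, h', TensorProduct.tmul_ite]
        rw [Finset.sum_eq_single w (fun x _ hx => if_neg hx) (by simp), if_pos rfl])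

theorem iso_comul_apply (x : IsoSpace Λ Λ) :
    Coalgebra.comul (R := ℂ) x = IsoSpace.comp Λ Λ Λ x := rfl

theorem iso_counit_apply (x : IsoSpace Λ Λ) :
    Coalgebra.counit (R := ℂ) x = IsoSpace.counit Λ x := rfl

/-- The antipode of `O(Λ)`: the linear anti-multiplicative map with `u_{v,w} ↦ u_{w,v}`,
`u_{e,f} ↦ u_{f,e}`. -/
def IsoSpace.antipode : IsoSpace Λ Λ →ₗ[ℂ] IsoSpace Λ Λ :=
  (MulOpposite.opLinearEquiv ℂ).symm.toLinearMap ∘ₗ (IsoSpace.inv Λ Λ).toAlgHom.toLinearMap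

theorem IsoSpace.antipode_mul (a b : IsoSpace Λ Λ) :
    IsoSpace.antipode Λ (a * b) = IsoSpace.antipode Λ b * IsoSpace.antipode Λ a := by
  change (IsoSpace.inv Λ Λ (a * b)).unop = _
  rw [map_mul]; rfl

theorem IsoSpace.antipode_vertex (v w : V) :
    IsoSpace.antipode Λ (IsoSpace.vertex Λ Λ v w) = IsoSpace.vertex Λ Λ w v :=
  congrArg MulOpposite.unop (IsoSpace.inv_vertex Λ Λ v w)

theorem IsoSpace.antipode_edge (v w : E) :
    IsoSpace.antipode Λ (IsoSpace.edge Λ Λ v w) = IsoSpace.edge Λ Λ w v :=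
  congrArg MulOpposite.unop (IsoSpace.inv_edge Λ Λ v w)

theorem IsoSpace.antipode_one : IsoSpace.antipode Λ 1 = 1 := by
  change (IsoSpace.inv Λ Λ 1).unop = _
  rw [map_one]; rfl

/-- `m (S ⊗ id)`. -/
def IsoSpace.convLeft : IsoSpace Λ Λ ⊗[ℂ] IsoSpace Λ Λ →ₗ[ℂ] IsoSpace Λ Λ :=
  LinearMap.mul' ℂ (IsoSpace Λ Λ) ∘ₗ (IsoSpace.antipode Λ).rTensor (IsoSpace Λ Λ)

/-- `m (id ⊗ S)`. -/
def IsoSpace.convRight : IsoSpace Λ Λ ⊗[ℂ] IsoSpace Λ Λ →ₗ[ℂ] IsoSpace Λ Λ :=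
  LinearMap.mul' ℂ (IsoSpace Λ Λ) ∘ₗ (IsoSpace.antipode Λ).lTensor (IsoSpace Λ Λ)

theorem IsoSpace.convLeft_tmul (a b : IsoSpace Λ Λ) :
    IsoSpace.convLeft Λ (a ⊗ₜ b) = IsoSpace.antipode Λ a * b := rfl

theorem IsoSpace.convRight_tmul (a b : IsoSpace Λ Λ) :
    IsoSpace.convRight Λ (a ⊗ₜ b) = a * IsoSpace.antipode Λ b := rfl

theorem IsoSpace.convLeft_mul {I : Type*} [Fintype I] (u : I → IsoSpace Λ Λ) (w : I → IsoSpace Λ Λ) (c : ℂ)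
    (h : ∑ i, IsoSpace.antipode Λ (u i) * w i = algebraMap ℂ _ c) (t : IsoSpace Λ Λ ⊗[ℂ] IsoSpace Λ Λ) :
    IsoSpace.convLeft Λ ((∑ i, u i ⊗ₜ w i) * t) = c • IsoSpace.convLeft Λ t := by
  induction t using TensorProduct.induction_on with
  | zero => simp
  | add x y hx hy => rw [mul_add, map_add, hx, hy, map_add, smul_add]
  | tmul a b =>
    rw [Finset.sum_mul, map_sum]
    simp only [Algebra.TensorProduct.tmul_mul_tmul, IsoSpace.convLeft_tmul, IsoSpace.antipode_mul]
    calc ∑ i, IsoSpace.antipode Λ a * IsoSpace.antipode Λ (u i) * (w i * b)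
        = IsoSpace.antipode Λ a * (∑ i, IsoSpace.antipode Λ (u i) * w i) * b := by
          simp only [Finset.mul_sum, Finset.sum_mul, mul_assoc]
      _ = _ := by rw [h, ← Algebra.commutes, mul_assoc, Algebra.smul_def]

theorem IsoSpace.convRight_mul {I : Type*} [Fintype I] (u : I → IsoSpace Λ Λ) (w : I → IsoSpace Λ Λ) (c : ℂ)
    (h : ∑ i, u i * IsoSpace.antipode Λ (w i) = algebraMap ℂ _ c) (t : IsoSpace Λ Λ ⊗[ℂ] IsoSpace Λ Λ) :
    IsoSpace.convRight Λ (t * (∑ i, u i ⊗ₜ w i)) = c • IsoSpace.convRight Λ t := by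
  induction t using TensorProduct.induction_on with
  | zero => simp
  | add x y hx hy => rw [add_mul, map_add, hx, hy, map_add, smul_add]
  | tmul a b =>
    rw [Finset.mul_sum, map_sum]
    simp only [Algebra.TensorProduct.tmul_mul_tmul, IsoSpace.convRight_tmul, IsoSpace.antipode_mul]
    calc ∑ i, a * u i * (IsoSpace.antipode Λ (w i) * IsoSpace.antipode Λ b)
        = a * (∑ i, u i * IsoSpace.antipode Λ (w i)) * IsoSpace.antipode Λ b := by
          simp only [Finset.mul_sum, Finset.sum_mul, mul_assoc]
      _ = _ := by rw [h, ← Algebra.commutes, mul_assoc, Algebra.smul_def]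

theorem IsoSpace.convLeft_comp_mul (x y : IsoSpace Λ Λ) : IsoSpace.convLeft Λ (IsoSpace.comp Λ Λ Λ (x * y)) =
    IsoSpace.counit Λ x • IsoSpace.convLeft Λ (IsoSpace.comp Λ Λ Λ y) := by
  induction x using IsoSpace.induction generalizing y with
  | scalar c =>
    rw [← Algebra.smul_def, map_smul, map_smul, AlgHomClass.commutes]; rfl
  | vertex v w =>
    rw [map_mul, IsoSpace.comp_vertex]
    refine IsoSpace.convLeft_mul Λ _ _ _ ?_ _
    simp only [IsoSpace.antipode_vertex, IsoSpace.counit_vertex]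
    exact (IsoSpace.isQuantumIso Λ Λ).magic_vertex.sum_row_mul v w
  | edge v w =>
    rw [map_mul, IsoSpace.comp_edge]
    refine IsoSpace.convLeft_mul Λ _ _ _ ?_ _
    simp only [IsoSpace.antipode_edge, IsoSpace.counit_edge]
    exact (IsoSpace.isQuantumIso Λ Λ).magic_edge.sum_row_mul v w
  | mul a b ha hb => rw [mul_assoc, ha, hb, map_mul, mul_smul]
  | add a b ha hb => rw [add_mul, map_add, map_add, ha, hb, map_add, add_smul]

theorem IsoSpace.convRight_comp_mul (x y : IsoSpace Λ Λ) : IsoSpace.convRight Λ (IsoSpace.comp Λ Λ Λ (y * x)) =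
    IsoSpace.counit Λ x • IsoSpace.convRight Λ (IsoSpace.comp Λ Λ Λ y) := by
  induction x using IsoSpace.induction generalizing y with
  | scalar c =>
    rw [← Algebra.commutes, ← Algebra.smul_def, map_smul, map_smul, AlgHomClass.commutes]; rfl
  | vertex v w =>
    rw [map_mul, IsoSpace.comp_vertex]
    refine IsoSpace.convRight_mul Λ _ _ _ ?_ _
    simp only [IsoSpace.antipode_vertex, IsoSpace.counit_vertex]
    exact (IsoSpace.isQuantumIso Λ Λ).magic_vertex.sum_col_mul v w
  | edge v w =>
    rw [map_mul, IsoSpace.comp_edge]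
    refine IsoSpace.convRight_mul Λ _ _ _ ?_ _
    simp only [IsoSpace.antipode_edge, IsoSpace.counit_edge]
    exact (IsoSpace.isQuantumIso Λ Λ).magic_edge.sum_col_mul v w
  | mul a b ha hb => rw [← mul_assoc, hb, ha, map_mul, mul_comm, mul_smul]
  | add a b ha hb => rw [mul_add, map_add, map_add, ha, hb, map_add, add_smul]

/-- The Hopf algebra structure of `O(Λ)`. -/
instance isoHopfAlgebra : HopfAlgebra ℂ (IsoSpace Λ Λ) where
  toBialgebra := isoBialgebra Λ
  antipode := IsoSpace.antipode Λ
  mul_antipode_rTensor_comul := by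
    refine LinearMap.ext fun x => ?_
    have h := IsoSpace.convLeft_comp_mul Λ x 1
    rw [mul_one, map_one, Algebra.TensorProduct.one_def, IsoSpace.convLeft_tmul, IsoSpace.antipode_one,
      mul_one, ← Algebra.algebraMap_eq_smul_one] at h
    exact h
  mul_antipode_lTensor_comul := by
    refine LinearMap.ext fun x => ?_
    have h := IsoSpace.convRight_comp_mul Λ x 1
    rw [one_mul, map_one, Algebra.TensorProduct.one_def, IsoSpace.convRight_tmul, IsoSpace.antipode_one,
      mul_one, ← Algebra.algebraMap_eq_smul_one] at h
    exact h

theorem iso_antipode_apply (x : IsoSpace Λ Λ) :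
    HopfAlgebra.antipode ℂ x = IsoSpace.antipode Λ x := rfl

end Hopf

/-! ## Hopf `*`-algebras, comodule algebras and bi-Galois extensions -/

/-- A Hopf `*`-algebra: a complex Hopf algebra with a conjugate-linear involution such that the
comultiplication and the counit are `*`-preserving. -/
class HopfStarAlgebra (H : Type*) [Ring H] [StarRing H] [HopfAlgebra ℂ H] : Prop
    extends StarModule ℂ H where
  comul_star : ∀ a : H, Coalgebra.comul (R := ℂ) (star a) = star (Coalgebra.comul (R := ℂ) a)
  counit_star : ∀ a : H, Coalgebra.counit (R := ℂ) (star a) = star (Coalgebra.counit (R := ℂ) a)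

instance isoHopfStarAlgebra {V E : Type*} [Fintype V] [Fintype E] (Λ : Hypergraph V E) :
    HopfStarAlgebra (IsoSpace Λ Λ) where
  comul_star a := map_star (IsoSpace.comp Λ Λ Λ) a
  counit_star a := map_star (IsoSpace.counit Λ) a

section BiGalois

variable {H K Z : Type*} [Ring H] [StarRing H] [HopfAlgebra ℂ H] [HopfStarAlgebra H]
  [Ring K] [StarRing K] [HopfAlgebra ℂ K] [HopfStarAlgebra K]
  [Ring Z] [StarRing Z] [Algebra ℂ Z] [StarModule ℂ Z]

/-- `δ` makes `Z` a left `H`-`*`-comodule algebra. -/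
structure IsLeftCoaction (δ : Z →⋆ₐ[ℂ] H ⊗[ℂ] Z) : Prop where
  coassoc : ∀ z, TensorProduct.map LinearMap.id δ.toAlgHom.toLinearMap (δ z) =
    TensorProduct.assoc ℂ H H Z (TensorProduct.map Coalgebra.comul LinearMap.id (δ z))
  counit : ∀ z, TensorProduct.lid ℂ Z (TensorProduct.map Coalgebra.counit LinearMap.id (δ z)) = z

/-- `γ` makes `Z` a right `K`-`*`-comodule algebra. -/
structure IsRightCoaction (γ : Z →⋆ₐ[ℂ] Z ⊗[ℂ] K) : Prop where
  coassoc : ∀ z, TensorProduct.assoc ℂ Z K K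
      (TensorProduct.map γ.toAlgHom.toLinearMap LinearMap.id (γ z)) =
    TensorProduct.map LinearMap.id Coalgebra.comul (γ z)
  counit : ∀ z, TensorProduct.rid ℂ Z (TensorProduct.map LinearMap.id Coalgebra.counit (γ z)) = z

/-- The left canonical map `Z ⊗ Z → H ⊗ Z`, `z ⊗ z' ↦ δ(z) (1 ⊗ z')`. -/
def leftCanonical (δ : Z →⋆ₐ[ℂ] H ⊗[ℂ] Z) : Z ⊗[ℂ] Z →ₗ[ℂ] H ⊗[ℂ] Z :=
  LinearMap.mul' ℂ (H ⊗[ℂ] Z) ∘ₗ TensorProduct.map δ.toAlgHom.toLinearMap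
    (Algebra.TensorProduct.includeRight : Z →ₐ[ℂ] H ⊗[ℂ] Z).toLinearMap

/-- The right canonical map `Z ⊗ Z → Z ⊗ K`, `z ⊗ z' ↦ (z ⊗ 1) γ(z')`. -/
def rightCanonical (γ : Z →⋆ₐ[ℂ] Z ⊗[ℂ] K) : Z ⊗[ℂ] Z →ₗ[ℂ] Z ⊗[ℂ] K :=
  LinearMap.mul' ℂ (Z ⊗[ℂ] K) ∘ₗ TensorProduct.map
    (Algebra.TensorProduct.includeLeft : Z →ₐ[ℂ] Z ⊗[ℂ] K).toLinearMap γ.toAlgHom.toLinearMap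

theorem leftCanonical_tmul (δ : Z →⋆ₐ[ℂ] H ⊗[ℂ] Z) (z z' : Z) :
    leftCanonical δ (z ⊗ₜ z') = δ z * (1 ⊗ₜ z') := rfl

theorem rightCanonical_tmul (γ : Z →⋆ₐ[ℂ] Z ⊗[ℂ] K) (z z' : Z) :
    rightCanonical γ (z ⊗ₜ z') = (z ⊗ₜ 1) * γ z' := rfl

/-- `Z`, with the coactions `δ` and `γ`, is an `H`-`K` bi-Galois extension. -/
structure IsBiGalois (δ : Z →⋆ₐ[ℂ] H ⊗[ℂ] Z) (γ : Z →⋆ₐ[ℂ] Z ⊗[ℂ] K) : Prop where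
  left : IsLeftCoaction δ
  right : IsRightCoaction γ
  commute : ∀ z, TensorProduct.assoc ℂ H Z K
      (TensorProduct.map δ.toAlgHom.toLinearMap LinearMap.id (γ z)) =
    TensorProduct.map LinearMap.id γ.toAlgHom.toLinearMap (δ z)
  left_bijective : Function.Bijective (leftCanonical δ)
  right_bijective : Function.Bijective (rightCanonical γ)

end BiGalois

section Coactions

variable {V₁ E₁ V₂ E₂ : Type*} [Fintype V₁] [Fintype E₁] [Fintype V₂] [Fintype E₂]
  (Λ₁ : Hypergraph V₁ E₁) (Λ₂ : Hypergraph V₂ E₂)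

/-- The left coaction `δ : O(Λ₁, Λ₂) → O(Λ₁) ⊗ O(Λ₁, Λ₂)`,
`p_{v,w} ↦ ∑ x, u_{v,x} ⊗ p_{x,w}` and `p_{e,f} ↦ ∑ d, u_{e,d} ⊗ p_{d,f}`. -/
def leftCoaction : IsoSpace Λ₁ Λ₂ →⋆ₐ[ℂ] IsoSpace Λ₁ Λ₁ ⊗[ℂ] IsoSpace Λ₁ Λ₂ := IsoSpace.comp Λ₁ Λ₁ Λ₂

/-- The right coaction `γ : O(Λ₁, Λ₂) → O(Λ₁, Λ₂) ⊗ O(Λ₂)`,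
`p_{v,w} ↦ ∑ x, p_{v,x} ⊗ u_{x,w}` and `p_{e,f} ↦ ∑ g, p_{e,g} ⊗ u_{g,f}`. -/
def rightCoaction : IsoSpace Λ₁ Λ₂ →⋆ₐ[ℂ] IsoSpace Λ₁ Λ₂ ⊗[ℂ] IsoSpace Λ₂ Λ₂ := IsoSpace.comp Λ₁ Λ₂ Λ₂

end Coactions

/-! ## Non-local games and no-signalling quotients -/

/-- The rule function `λ : X × Y × A × B → {0, 1}` of a non-local game, with `true` for winning. -/
abbrev NonlocalGame (X Y A B : Type*) := X → Y → A → B → Bool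

/-- The hypergraph of winning pairs `Λ_G ⊆ (X × Y) × (A × B)` of a game. -/
def NonlocalGame.hypergraph {X Y A B : Type*} (G : NonlocalGame X Y A B) :
    Hypergraph (X × Y) (A × B) :=
  {t | G t.1.1 t.1.2 t.2.1 t.2.2 = true}

section NS

variable {X₁ Y₁ A₁ B₁ X₂ Y₂ A₂ B₂ : Type*} [Fintype X₁] [Fintype Y₁] [Fintype A₁] [Fintype B₁]
  [Fintype X₂] [Fintype Y₂] [Fintype A₂] [Fintype B₂]

/-- No-signalling marginal equalities for a matrix `P` with rows in `S × T` and columns in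
`S' × T'`: the sum over the first row coordinate is independent of the first column coordinate, and
the sum over the second row coordinate is independent of the second column coordinate. -/
inductive MarginalRel {S T S' T' R : Type*} [Fintype S] [Fintype T] [Ring R]
    (P : Matrix (S × T) (S' × T') R) : R → R → Prop
  | fst (t : T) (t' : T') (s' s'' : S') :
      MarginalRel P (∑ s, P (s, t) (s', t')) (∑ s, P (s, t) (s'', t'))
  | snd (s : S) (s' : S') (t' t'' : T') :
      MarginalRel P (∑ t, P (s, t) (s', t')) (∑ t, P (s, t) (s', t''))

/-- The no-signalling relations in `O(Λ_{G₁}, Λ_{G₂})`: on the question block sums run over the row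
coordinates, on the answer block over the column coordinates. -/
inductive NSRel (G₁ : NonlocalGame X₁ Y₁ A₁ B₁) (G₂ : NonlocalGame X₂ Y₂ A₂ B₂) :
    IsoSpace G₁.hypergraph G₂.hypergraph → IsoSpace G₁.hypergraph G₂.hypergraph → Prop
  | question {a b} (h : MarginalRel (IsoSpace.vertex G₁.hypergraph G₂.hypergraph) a b) : NSRel G₁ G₂ a b
  | answer {a b} (h : MarginalRel (IsoSpace.edge G₁.hypergraph G₂.hypergraph).transpose a b) :
      NSRel G₁ G₂ a b

/-- The no-signalling relations in `O(Λ_G)`: on both blocks sums run over the row coordinates. -/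
inductive AutNSRel (G : NonlocalGame X₁ Y₁ A₁ B₁) :
    IsoSpace G.hypergraph G.hypergraph → IsoSpace G.hypergraph G.hypergraph → Prop
  | question {a b} (h : MarginalRel (IsoSpace.vertex G.hypergraph G.hypergraph) a b) : AutNSRel G a b
  | answer {a b} (h : MarginalRel (IsoSpace.edge G.hypergraph G.hypergraph) a b) : AutNSRel G a b

/-- The `*`-ideal `I_NS` of `O(Λ_{G₁}, Λ_{G₂})`. -/
abbrev nsIdeal (G₁ : NonlocalGame X₁ Y₁ A₁ B₁) (G₂ : NonlocalGame X₂ Y₂ A₂ B₂) :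
    Ideal (IsoSpace G₁.hypergraph G₂.hypergraph) := starIdeal (NSRel G₁ G₂)

/-- The `*`-ideal `J` of `O(Λ_G)`. -/
abbrev autNSIdeal (G : NonlocalGame X₁ Y₁ A₁ B₁) : Ideal (IsoSpace G.hypergraph G.hypergraph) :=
  starIdeal (AutNSRel G)

/-- The no-signalling quotient `O_NS(G₁, G₂) = O(Λ_{G₁}, Λ_{G₂}) / I_NS`. -/
abbrev ONS (G₁ : NonlocalGame X₁ Y₁ A₁ B₁) (G₂ : NonlocalGame X₂ Y₂ A₂ B₂) : Type _ :=
  IsoSpace G₁.hypergraph G₂.hypergraph ⧸ nsIdeal G₁ G₂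

/-- The quotient `O(Λ_G) / J`. (Once `J` is known to be a Hopf ideal it carries the quotient Hopf
algebra structure, through the general instance for quotients by Hopf ideals.) -/
abbrev HNS (G : NonlocalGame X₁ Y₁ A₁ B₁) : Type _ :=
  IsoSpace G.hypergraph G.hypergraph ⧸ autNSIdeal G

/-- The quotient map `q : O(Λ_{G₁}, Λ_{G₂}) → O_NS(G₁, G₂)`. -/
abbrev ONS.quot (G₁ : NonlocalGame X₁ Y₁ A₁ B₁) (G₂ : NonlocalGame X₂ Y₂ A₂ B₂) :
    IsoSpace G₁.hypergraph G₂.hypergraph →⋆ₐ[ℂ] ONS G₁ G₂ := quotientMap (nsIdeal G₁ G₂)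

/-- The quotient map `π : O(Λ_G) → O(Λ_G) / J`. -/
abbrev HNS.quot (G : NonlocalGame X₁ Y₁ A₁ B₁) :
    IsoSpace G.hypergraph G.hypergraph →⋆ₐ[ℂ] HNS G := quotientMap (autNSIdeal G)

end NS

end QIso

end

open QIso

noncomputable section

namespace QIso

set_option linter.unusedSectionVars false

/-! ### No-signalling marginals of a magic unitary, and their invariance under transposition. -/

section Marginals

variable {A : Type*} [Ring A] [StarRing A] [Algebra ℂ A]

/-! The obstacle is an asymmetry in the relations: $I_{\mathrm{NS}}$ sums over rows on the question
block and over columns on the answer block, while $J_i$ sums over rows on both, and antipodes and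
translation maps exchange rows with columns. The key fact is that for a magic unitary $P$ the row
and column versions of the marginal equalities are equivalent (`HasMarginals.transpose`,
`HasMarginals.of_transpose`).

To see this, let $E_{t,t'}=\sum_x P_{(x,t),(s',t')}$ and $F_{s,s'}=\sum_y P_{(s,y),(s',t')}$; by
assumption they do not depend on the suppressed column coordinate. Orthogonality in columns gives
$P_{(s,t),(s',t')}=E_{t,t'}F_{s,s'}=F_{s,s'}E_{t,t'}$. Orthogonality in rows, together with $\sum_t
E_{t,t'}=1$, makes $F_{s,s_1}$ and $F_{s,s_2}$ orthogonal for $s_1\ne s_2$, so $R=\sum_{s'}F_{s,s'}$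
is idempotent. Counting entries gives $|T'|\,R=|T|\,1$, so $R$ is an idempotent nonzero multiple of
$1$, that is $R=1$ (`HasMarginals.sum_sum_snd`). Hence $\sum_{s'}P_{(s,t),(s',t')}=E_{t,t'}$, which
no longer involves $s$: this is the transposed equality.

After that the argument is formal. Quantum isomorphisms with marginals on both blocks (`IsNSIso`)
contain the identity and are closed under composition in tensor products and under transposition
into the opposite algebra; $\mathcal O_{\mathrm{NS}}$ and $H_i$ are universal for them (`ONS.lift`,
`HNS.lift`). Universality supplies the coproduct, counit and antipode on $H_i$, both coactions, and
translation maps $\psi$ with $u_{ik}\mapsto\sum_j p_{ij}\otimes p_{kj}^{\mathrm{op}}$ on $H_1$ and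
$u_{jl}\mapsto\sum_i p_{ij}^{\mathrm{op}}\otimes p_{il}$ on $H_2$. Inverses of the canonical maps
are built from these, and the inverse identities reduce on generators to $\sum_j
p_{ij}p_{kj}=\delta_{ik}$ and $\sum_i p_{ij}p_{il}=\delta_{jl}$. -/

theorem IsMagicUnitary.submatrix {I J I' J' : Type*} [Fintype I] [Fintype J] [Fintype I']
    [Fintype J'] {u : Matrix I J A} (hu : IsMagicUnitary u) (e : I' ≃ I) (f : J' ≃ J) :
    IsMagicUnitary (u.submatrix e f) := by
  intro a b r
  cases r with
  | star_eq i j => exact hu _ _ (.star_eq _ _)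
  | idem i j => exact hu _ _ (.idem _ _)
  | row_sum i => exact (Equiv.sum_comp f fun j => u (e i) j).trans (hu _ _ (.row_sum _))
  | col_sum j => exact (Equiv.sum_comp e fun i => u i (f j)).trans (hu _ _ (.col_sum _))
  | row_orth i j j' h => exact hu _ _ (.row_orth _ _ _ (f.injective.ne h))
  | col_orth j i i' h => exact hu _ _ (.col_orth _ _ _ (e.injective.ne h))

/-- The no-signalling marginal equalities hold for `P`. -/
def HasMarginals {S T S' T' R : Type*} [Fintype S] [Fintype T] [Ring R]
    (P : Matrix (S × T) (S' × T') R) : Prop := ∀ a b, MarginalRel P a b → a = b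

variable {S T S' T' : Type*} [Fintype S] [Fintype T] [Fintype S'] [Fintype T']
  {P : Matrix (S × T) (S' × T') A}

theorem HasMarginals.submatrix_swap (h : HasMarginals P) :
    HasMarginals (P.submatrix (Equiv.prodComm T S) (Equiv.prodComm T' S')) := by
  intro a b r
  cases r with
  | fst s s' t' t'' => exact h _ _ (.snd s s' t' t'')
  | snd t t' s' s'' => exact h _ _ (.fst t t' s' s'')

/-- The first marginal is a sum over a column, hence idempotent. -/
theorem IsMagicUnitary.sum_fst_mul_self (hP : IsMagicUnitary P) (t : T) (k : S' × T') :
    (∑ x, P (x, t) k) * ∑ x, P (x, t) k = ∑ x, P (x, t) k := by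
  classical
  simp only [Finset.sum_mul_sum, hP.col_mul]
  simp

/-- Both factors are sums of entries of the single column `k`, so orthogonality in that column
leaves only the index common to the two sums. -/
theorem IsMagicUnitary.sum_fst_mul_sum_snd (hP : IsMagicUnitary P) (s : S) (t : T)
    (k : S' × T') : (∑ x, P (x, t) k) * ∑ y, P (s, y) k = P (s, t) k := by
  classical
  simp only [Finset.sum_mul_sum, hP.col_mul, Prod.mk.injEq]
  rw [Finset.sum_eq_single s, Finset.sum_eq_single t] <;> simp +contextual [eq_comm]

theorem IsMagicUnitary.sum_snd_mul_sum_fst (hP : IsMagicUnitary P) (s : S) (t : T)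
    (k : S' × T') : (∑ y, P (s, y) k) * ∑ x, P (x, t) k = P (s, t) k := by
  classical
  simp only [Finset.sum_mul_sum, hP.col_mul, Prod.mk.injEq]
  rw [Finset.sum_eq_single t, Finset.sum_eq_single s] <;> simp +contextual [eq_comm]

theorem IsMagicUnitary.sum_sum_fst (hP : IsMagicUnitary P) (k : S' × T') :
    ∑ t, ∑ x, P (x, t) k = 1 := by
  rw [Finset.sum_comm, ← Fintype.sum_prod_type fun i => P i k]
  exact hP _ _ (.col_sum k)

/-- A magic unitary with no-signalling marginals is the product of its two commuting marginals. -/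
theorem HasMarginals.eq_mul (h : HasMarginals P) (hP : IsMagicUnitary P) (s : S) (t : T)
    (s' s'' : S') (t' t'' : T') :
    P (s, t) (s', t') = (∑ x, P (x, t) (s'', t')) * ∑ y, P (s, y) (s', t'') := by
  rw [h _ _ (.fst t t' s'' s'), h _ _ (.snd s s' t'' t'), hP.sum_fst_mul_sum_snd]

theorem HasMarginals.eq_mul' (h : HasMarginals P) (hP : IsMagicUnitary P) (s : S) (t : T)
    (s' s'' : S') (t' t'' : T') :
    P (s, t) (s', t') = (∑ y, P (s, y) (s', t'')) * ∑ x, P (x, t) (s'', t') := by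
  rw [h _ _ (.fst t t' s'' s'), h _ _ (.snd s s' t'' t'), hP.sum_snd_mul_sum_fst]

/-- The two second marginals cannot be compared entry by entry, since row orthogonality only
concerns a fixed row `(s, t)`. Multiplying by the first marginal at `t` cuts down to that row, and
these first marginals sum to `1` over `t`. -/
theorem HasMarginals.snd_orth (h : HasMarginals P) (hP : IsMagicUnitary P) (s : S) (t' : T')
    {s₁ s₂ : S'} (hs : s₁ ≠ s₂) :
    (∑ y, P (s, y) (s₁, t')) * ∑ y, P (s, y) (s₂, t') = 0 := by
  have key : ∀ t, (∑ y, P (s, y) (s₁, t')) * (∑ y, P (s, y) (s₂, t')) *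
      ∑ x, P (x, t) (s₁, t') = 0 := by
    intro t
    -- With $E$ the first marginal at `t` and $F_1,F_2$ the second marginals:
    -- $F_1F_2E=F_1EF_2=(F_1E)(EF_2)$, since $E$ is idempotent and commutes with $F_2$. The same $E$
    -- serves for both columns because it does not depend on `s₁` or `s₂`.
    calc _ = (∑ y, P (s, y) (s₁, t')) * (P (s, t) (s₂, t') * ∑ x, P (x, t) (s₁, t')) := by
          rw [h.eq_mul' hP s t s₂ s₁ t' t', mul_assoc, mul_assoc, hP.sum_fst_mul_self]
      _ = P (s, t) (s₁, t') * P (s, t) (s₂, t') := by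
          rw [h.eq_mul hP s t s₂ s₁ t' t', h.eq_mul' hP s t s₁ s₁ t' t']
          rw [mul_assoc _ (∑ y, P (s, y) (s₂, t')), ← h.eq_mul' hP s t s₂ s₁ t' t',
            h.eq_mul hP s t s₂ s₁ t' t', mul_assoc, ← mul_assoc (∑ x, P (x, t) (s₁, t')),
            hP.sum_fst_mul_self]
      _ = 0 := hP _ _ (.row_orth _ _ _ (by simp [hs]))
  calc _ = (∑ y, P (s, y) (s₁, t')) * (∑ y, P (s, y) (s₂, t')) *
      ∑ t, ∑ x, P (x, t) (s₁, t') := by rw [hP.sum_sum_fst, mul_one]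
    _ = 0 := by rw [Finset.mul_sum]; exact Finset.sum_eq_zero fun t _ => key t

/-- An idempotent that is a nonzero scalar multiple of `1` is `1`: orthogonality of the second
marginals gives idempotence, and a double count of entries gives the scalar. If `T` were empty the
sum would be `0`, hence the nonemptiness assumption. -/
theorem HasMarginals.sum_sum_snd (h : HasMarginals P) (hP : IsMagicUnitary P) [Nonempty T]
    (s : S) (t' : T') : ∑ s', ∑ y, P (s, y) (s', t') = 1 := by
  classical
  set R := ∑ s', ∑ y, P (s, y) (s', t') with hR
  have hidem : R * R = R := by
    rw [hR, Finset.sum_mul_sum]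
    refine Finset.sum_congr rfl fun s₁ _ => ?_
    rw [Finset.sum_eq_single s₁ (fun s₂ _ hs => h.snd_orth hP s t' hs.symm) (by simp)]
    simp only [Finset.sum_mul_sum, hP.col_mul]
    simp
  -- The sum of all entries in the rows `(s, y)`, `y` in `T`, counted twice: each column coordinate
  -- `t''` contributes `R` by the marginal equalities, and each row contributes `1`.
  have hcard : (Fintype.card T' : ℂ) • R = (Fintype.card T : ℂ) • (1 : A) := by
    calc (Fintype.card T' : ℂ) • R = ∑ t'', ∑ s', ∑ y, P (s, y) (s', t'') := by
          rw [Finset.sum_congr rfl fun t'' _ => Finset.sum_congr rfl fun s' _ =>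
            h _ _ (.snd s s' t'' t')]
          simp [hR, Nat.cast_smul_eq_nsmul]
      _ = ∑ y, ∑ k : S' × T', P (s, y) k := by
          simp only [Fintype.sum_prod_type]
          rw [Finset.sum_comm, Finset.sum_comm (s := (Finset.univ : Finset T))]
          refine Finset.sum_congr rfl fun _ _ => Finset.sum_comm
      _ = _ := by
          rw [Finset.sum_congr rfl fun y _ => hP _ _ (.row_sum (s, y))]
          simp [Nat.cast_smul_eq_nsmul]
  have h1 : (Fintype.card T' : ℂ) ≠ 0 := by
    have : Nonempty T' := ⟨t'⟩
    simp
  have h2 : (Fintype.card T : ℂ) ≠ 0 := by simp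
  have hc : R = ((Fintype.card T : ℂ) / Fintype.card T') • (1 : A) := by
    rw [div_eq_inv_mul, mul_smul, ← hcard, inv_smul_smul₀ h1]
  -- With $R=c\cdot 1$, idempotence reads $R=R^2=cR$, so $cR=c\cdot1$, and $c\neq0$ can be
  -- cancelled.
  have h3 : ((Fintype.card T : ℂ) / Fintype.card T') • R =
      ((Fintype.card T : ℂ) / Fintype.card T') • (1 : A) := by
    rw [← hc]
    nth_rewrite 2 [← hidem]
    nth_rewrite 2 [hc]
    rw [smul_mul_assoc, one_mul]
  exact smul_right_injective A (div_ne_zero h2 h1) h3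

/-- The bridge between rows and columns: in $P=EF$ the factor $E$ is constant in `s'` and the
factors $F$ add up to `1`. The right-hand side does not mention `s`, which is what the transposed
marginal equality needs. -/
theorem HasMarginals.sum_fst_transpose (h : HasMarginals P) (hP : IsMagicUnitary P) (s : S)
    (t : T) (s'' : S') (t' : T') :
    ∑ s', P (s, t) (s', t') = ∑ x, P (x, t) (s'', t') := by
  have : Nonempty T := ⟨t⟩
  rw [Finset.sum_congr rfl fun s' _ => h.eq_mul hP s t s' s'' t' t', ← Finset.mul_sum,
    h.sum_sum_snd hP s t', mul_one]

theorem HasMarginals.transpose_fst (h : HasMarginals P) (hP : IsMagicUnitary P) (s₁ s₂ : S)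
    (t : T) (t' : T') : ∑ s', P (s₁, t) (s', t') = ∑ s', P (s₂, t) (s', t') := by
  rcases isEmpty_or_nonempty S' with hS | ⟨⟨s''⟩⟩
  · simp
  · rw [h.sum_fst_transpose hP s₁ t s'' t', h.sum_fst_transpose hP s₂ t s'' t']

/-- For a magic unitary, the marginal equalities pass to the transpose. -/
theorem HasMarginals.transpose (h : HasMarginals P) (hP : IsMagicUnitary P) :
    HasMarginals P.transpose := by
  intro a b r
  cases r with
  | fst t' t s₁ s₂ => exact h.transpose_fst hP s₁ s₂ t t'
  -- Exchanging the two coordinates on both sides turns the second marginal into the first.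
  | snd s' s t₁ t₂ => exact h.submatrix_swap.transpose_fst (hP.submatrix _ _) t₁ t₂ s s'

/-- For a magic unitary, the marginal equalities may be checked on the transpose. -/
theorem HasMarginals.of_transpose (h : HasMarginals P.transpose) (hP : IsMagicUnitary P) :
    HasMarginals P := by
  -- The marginal equalities are additive, so they are insensitive to reversing the product; in the
  -- opposite algebra the transpose is already known to be a magic unitary, so the forward direction
  -- applies to it.
  have h' : HasMarginals (fun j i => MulOpposite.op (P i j) : Matrix (S' × T') (S × T) Aᵐᵒᵖ) := by
    intro a b r
    cases r with
    | fst t' t s₁ s₂ =>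
      rw [← Finset.op_sum, ← Finset.op_sum]
      exact congrArg MulOpposite.op (h _ _ (.fst t' t s₁ s₂))
    | snd s' s t₁ t₂ =>
      rw [← Finset.op_sum, ← Finset.op_sum]
      exact congrArg MulOpposite.op (h _ _ (.snd s' s t₁ t₂))
  intro a b r
  cases r with
  | fst t t' s₁ s₂ =>
    refine MulOpposite.op_injective ?_
    rw [Finset.op_sum, Finset.op_sum]
    exact h'.transpose hP.transpose_op _ _ (.fst t t' s₁ s₂)
  | snd s s' t₁ t₂ =>
    refine MulOpposite.op_injective ?_
    rw [Finset.op_sum, Finset.op_sum]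
    exact h'.transpose hP.transpose_op _ _ (.snd s s' t₁ t₂)

theorem HasMarginals.transpose_op (h : HasMarginals P) (hP : IsMagicUnitary P) :
    HasMarginals (fun j i => MulOpposite.op (P i j) : Matrix (S' × T') (S × T) Aᵐᵒᵖ) := by
  intro a b r
  cases r with
  | fst t' t s₁ s₂ =>
    rw [← Finset.op_sum, ← Finset.op_sum]
    exact congrArg MulOpposite.op (h.transpose hP _ _ (.fst t' t s₁ s₂))
  | snd s' s t₁ t₂ =>
    rw [← Finset.op_sum, ← Finset.op_sum]
    exact congrArg MulOpposite.op (h.transpose hP _ _ (.snd s' s t₁ t₂))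

theorem MarginalRel.map {B : Type*} [Ring B] [StarRing B] [Algebra ℂ B] {a b : A}
    (h : MarginalRel P a b) (f : A →⋆ₐ[ℂ] B) : MarginalRel (P.map f) (f a) (f b) := by
  cases h with
  | fst t t' s₁ s₂ =>
    simp only [map_sum]; exact .fst (P := P.map f) t t' s₁ s₂
  | snd s s' t₁ t₂ =>
    simp only [map_sum]; exact .snd (P := P.map f) s s' t₁ t₂

/-- The marginal of $P$ is constant in the suppressed middle coordinate, so the sum over that
coordinate moves onto $Q$: the marginals of the product matrix are the products of the marginals. No
magic unitary property is needed. -/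
theorem HasMarginals.tensorMul {B S'' T'' : Type*} [Ring B] [StarRing B] [Algebra ℂ B]
    [Fintype S''] [Fintype T''] {Q : Matrix (S' × T') (S'' × T'') B}
    (hP : HasMarginals P) (hQ : HasMarginals Q) : HasMarginals (tensorMul P Q) := by
  intro a b r
  cases r with
  | fst t t'' s₁ s₂ =>
    -- A reference value of the middle coordinate is needed to name the common marginal of `P`;
    -- without one, every sum over the middle index is empty.
    rcases isEmpty_or_nonempty S' with hS | ⟨⟨s'⟩⟩
    · simp [QIso.tensorMul]
    · have key : ∀ k : S'', ∑ s, QIso.tensorMul P Q (s, t) (k, t'') =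
          ∑ t', (∑ s, P (s, t) (s', t')) ⊗ₜ[ℂ] ∑ x, Q (x, t') (k, t'') := by
        intro k
        simp only [QIso.tensorMul]
        rw [Finset.sum_comm, Fintype.sum_prod_type, Finset.sum_comm]
        refine Finset.sum_congr rfl fun t' _ => ?_
        rw [TensorProduct.tmul_sum]
        refine Finset.sum_congr rfl fun x _ => ?_
        rw [← TensorProduct.sum_tmul, hP _ _ (.fst t t' x s')]
      rw [key, key]
      exact Finset.sum_congr rfl fun t' _ => by rw [hQ _ _ (.fst t' t'' s₁ s₂)]
  | snd s s'' t₁ t₂ =>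
    rcases isEmpty_or_nonempty T' with hT | ⟨⟨t'⟩⟩
    · simp [QIso.tensorMul]
    · have key : ∀ k : T'', ∑ t, QIso.tensorMul P Q (s, t) (s'', k) =
          ∑ s', (∑ t, P (s, t) (s', t')) ⊗ₜ[ℂ] ∑ y, Q (s', y) (s'', k) := by
        intro k
        simp only [QIso.tensorMul]
        rw [Finset.sum_comm, Fintype.sum_prod_type]
        refine Finset.sum_congr rfl fun s' _ => ?_
        rw [TensorProduct.tmul_sum]
        refine Finset.sum_congr rfl fun y _ => ?_
        rw [← TensorProduct.sum_tmul, hP _ _ (.snd s s' y t')]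
      rw [key, key]
      exact Finset.sum_congr rfl fun s' _ => by rw [hQ _ _ (.snd s' s'' t₁ t₂)]

theorem hasMarginals_one [DecidableEq (S × T)] : HasMarginals (1 : Matrix (S × T) (S × T) ℂ) := by
  intro a b r
  cases r with
  | fst t t' s₁ s₂ => classical simp [Matrix.one_apply, ite_and]
  | snd s s' t₁ t₂ => classical simp [Matrix.one_apply, ite_and]

end Marginals

/-! ### No-signalling quantum isomorphisms and the universal properties of the quotients. -/

section NSIso

variable {X₁ Y₁ A₁ B₁ X₂ Y₂ A₂ B₂ X₃ Y₃ A₃ B₃ : Type*} [Fintype X₁] [Fintype Y₁] [Fintype A₁]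
  [Fintype B₁] [Fintype X₂] [Fintype Y₂] [Fintype A₂] [Fintype B₂] [Fintype X₃] [Fintype Y₃]
  [Fintype A₃] [Fintype B₃]
  {R R' : Type*} [Ring R] [StarRing R] [Algebra ℂ R] [Ring R'] [StarRing R'] [Algebra ℂ R']
  {G₁ : NonlocalGame X₁ Y₁ A₁ B₁} {G₂ : NonlocalGame X₂ Y₂ A₂ B₂} {G₃ : NonlocalGame X₃ Y₃ A₃ B₃}

/-- A quantum isomorphism of games both of whose blocks have no-signalling marginals. -/
structure IsNSIso (G₁ : NonlocalGame X₁ Y₁ A₁ B₁) (G₂ : NonlocalGame X₂ Y₂ A₂ B₂)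
    (P : Matrix (X₁ × Y₁) (X₂ × Y₂) R) (Q : Matrix (A₁ × B₁) (A₂ × B₂) R) : Prop where
  iso : IsQuantumIso G₁.hypergraph G₂.hypergraph P Q
  question : HasMarginals P
  answer : HasMarginals Q

variable {P : Matrix (X₁ × Y₁) (X₂ × Y₂) R} {Q : Matrix (A₁ × B₁) (A₂ × B₂) R}

theorem IsNSIso.tensorMul [StarModule ℂ R] [StarModule ℂ R']
    {P' : Matrix (X₂ × Y₂) (X₃ × Y₃) R'} {Q' : Matrix (A₂ × B₂) (A₃ × B₃) R'}
    (h : IsNSIso G₁ G₂ P Q) (h' : IsNSIso G₂ G₃ P' Q') :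
    IsNSIso G₁ G₃ (tensorMul P P') (tensorMul Q Q') :=
  ⟨h.iso.tensorMul h'.iso, h.question.tensorMul h'.question, h.answer.tensorMul h'.answer⟩

theorem IsNSIso.transpose_op (h : IsNSIso G₁ G₂ P Q) :
    IsNSIso G₂ G₁ (fun v w => MulOpposite.op (P w v)) (fun e f => MulOpposite.op (Q f e)) :=
  ⟨h.iso.transpose_op, h.question.transpose_op h.iso.magic_vertex,
    h.answer.transpose_op h.iso.magic_edge⟩

theorem isNSIso_one [DecidableEq (X₁ × Y₁)] [DecidableEq (A₁ × B₁)] (G : NonlocalGame X₁ Y₁ A₁ B₁) :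
    IsNSIso G G (1 : Matrix (X₁ × Y₁) (X₁ × Y₁) ℂ) (1 : Matrix (A₁ × B₁) (A₁ × B₁) ℂ) :=
  ⟨by convert isQuantumIso_one G.hypergraph, hasMarginals_one, hasMarginals_one⟩

theorem IsMagicUnitary.map {I J : Type*} [Fintype I] [Fintype J] {u : Matrix I J R}
    (hu : IsMagicUnitary u) (f : R →⋆ₐ[ℂ] R') : IsMagicUnitary (u.map f) := by
  intro a b r
  cases r with
  | star_eq i j => exact (map_star f _).symm.trans (congrArg f (hu _ _ (.star_eq i j)))
  | idem i j => exact (map_mul f _ _).symm.trans (congrArg f (hu _ _ (.idem i j)))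
  | row_sum i =>
    exact (map_sum f _ _).symm.trans ((congrArg f (hu _ _ (.row_sum i))).trans (map_one f))
  | col_sum j =>
    exact (map_sum f _ _).symm.trans ((congrArg f (hu _ _ (.col_sum j))).trans (map_one f))
  | row_orth i j j' h =>
    exact (map_mul f _ _).symm.trans ((congrArg f (hu _ _ (.row_orth i j j' h))).trans (map_zero f))
  | col_orth j i i' h =>
    exact (map_mul f _ _).symm.trans ((congrArg f (hu _ _ (.col_orth j i i' h))).trans (map_zero f))

theorem IsQuantumIso.map {V₁ E₁ V₂ E₂ : Type*} [Fintype V₁] [Fintype E₁] [Fintype V₂]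
    [Fintype E₂] {Λ₁ : Hypergraph V₁ E₁} {Λ₂ : Hypergraph V₂ E₂} {P : Matrix V₁ V₂ R}
    {Q : Matrix E₁ E₂ R} (h : IsQuantumIso Λ₁ Λ₂ P Q) (f : R →⋆ₐ[ℂ] R') :
    IsQuantumIso Λ₁ Λ₂ (P.map f) (Q.map f) := by
  intro a b r
  cases r with
  | vertex r => exact h.magic_vertex.map f _ _ r
  | edge r => exact h.magic_edge.map f _ _ r
  | intertwine v g => simpa [map_sum, map_smul] using congrArg f (h _ _ (.intertwine v g))

variable (G₁ G₂)

/-- The question block of the generators of `O_NS(G₁, G₂)`. -/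
def ONS.vertex : Matrix (X₁ × Y₁) (X₂ × Y₂) (ONS G₁ G₂) :=
  (IsoSpace.vertex G₁.hypergraph G₂.hypergraph).map (ONS.quot G₁ G₂)

/-- The answer block of the generators of `O_NS(G₁, G₂)`. -/
def ONS.edge : Matrix (A₁ × B₁) (A₂ × B₂) (ONS G₁ G₂) :=
  (IsoSpace.edge G₁.hypergraph G₂.hypergraph).map (ONS.quot G₁ G₂)

/-- The question block of the generators of `O(Λ_G) / J`. -/
def HNS.vertex : Matrix (X₁ × Y₁) (X₁ × Y₁) (HNS G₁) :=
  (IsoSpace.vertex G₁.hypergraph G₁.hypergraph).map (HNS.quot G₁)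

/-- The answer block of the generators of `O(Λ_G) / J`. -/
def HNS.edge : Matrix (A₁ × B₁) (A₁ × B₁) (HNS G₁) :=
  (IsoSpace.edge G₁.hypergraph G₁.hypergraph).map (HNS.quot G₁)

theorem ONS.quot_eq {a b : IsoSpace G₁.hypergraph G₂.hypergraph} (h : NSRel G₁ G₂ a b) :
    ONS.quot G₁ G₂ a = ONS.quot G₁ G₂ b := Ideal.Quotient.eq.2 (sub_mem_starIdeal h)

theorem HNS.quot_eq {a b : IsoSpace G₁.hypergraph G₁.hypergraph} (h : AutNSRel G₁ a b) :
    HNS.quot G₁ a = HNS.quot G₁ b := Ideal.Quotient.eq.2 (sub_mem_starIdeal h)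

theorem hasMarginals_map {S T S' T' : Type*} [Fintype S] [Fintype T]
    {P : Matrix (S × T) (S' × T') R} (f : R →⋆ₐ[ℂ] R')
    (h : ∀ a b, MarginalRel P a b → f a = f b) : HasMarginals (P.map f) := by
  intro a b r
  cases r with
  | fst t t' s₁ s₂ =>
    exact (map_sum f _ _).symm.trans ((h _ _ (.fst t t' s₁ s₂)).trans (map_sum f _ _))
  | snd s s' t₁ t₂ =>
    exact (map_sum f _ _).symm.trans ((h _ _ (.snd s s' t₁ t₂)).trans (map_sum f _ _))

/-- On the answer block $I_{\mathrm{NS}}$ only imposes the column version of the marginal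
equalities; `HasMarginals.of_transpose` converts it to the row version, so that both blocks are
treated alike from here on. -/
theorem ONS.isNSIso : IsNSIso G₁ G₂ (ONS.vertex G₁ G₂) (ONS.edge G₁ G₂) where
  iso := (IsoSpace.isQuantumIso _ _).map _
  question := hasMarginals_map _ fun _ _ h => ONS.quot_eq G₁ G₂ (.question h)
  answer := by
    refine HasMarginals.of_transpose ?_ ((IsoSpace.isQuantumIso _ _).magic_edge.map _)
    exact hasMarginals_map (P := (IsoSpace.edge G₁.hypergraph G₂.hypergraph).transpose)
      (ONS.quot G₁ G₂) fun _ _ h => ONS.quot_eq G₁ G₂ (.answer h)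

theorem HNS.isNSIso : IsNSIso G₁ G₁ (HNS.vertex G₁) (HNS.edge G₁) where
  iso := (IsoSpace.isQuantumIso _ _).map _
  question := hasMarginals_map _ fun _ _ h => HNS.quot_eq G₁ (.question h)
  answer := hasMarginals_map _ fun _ _ h => HNS.quot_eq G₁ (.answer h)

variable {G₁ G₂}

theorem IsoSpace.vertex_map_lift [StarModule ℂ R]
    (h : IsQuantumIso G₁.hypergraph G₂.hypergraph P Q) :
    (IsoSpace.vertex _ _).map (IsoSpace.lift h) = P := by
  ext v w; exact IsoSpace.lift_vertex h v w

theorem IsoSpace.edge_map_lift [StarModule ℂ R] (h : IsQuantumIso G₁.hypergraph G₂.hypergraph P Q) :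
    (IsoSpace.edge _ _).map (IsoSpace.lift h) = Q := by
  ext v w; exact IsoSpace.lift_edge h v w

/-- The universal property of `O_NS(G₁, G₂)`. -/
def ONS.lift [StarModule ℂ R] (h : IsNSIso G₁ G₂ P Q) : ONS G₁ G₂ →⋆ₐ[ℂ] R :=
  starLift (IsoSpace.lift h.iso) fun a b r => by
    cases r with
    | question r =>
      have := r.map (IsoSpace.lift h.iso)
      rw [IsoSpace.vertex_map_lift] at this
      exact h.question _ _ this
    | answer r =>
      have := r.map (IsoSpace.lift h.iso)
      rw [Matrix.transpose_map, IsoSpace.edge_map_lift] at this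
      -- The converse conversion: the answer relations to be respected are those of the transposed
      -- block.
      exact h.answer.transpose h.iso.magic_edge _ _ this

/-- The universal property of `O(Λ_G) / J`. -/
def HNS.lift {P : Matrix (X₁ × Y₁) (X₁ × Y₁) R} {Q : Matrix (A₁ × B₁) (A₁ × B₁) R}
    [StarModule ℂ R] (h : IsNSIso G₁ G₁ P Q) : HNS G₁ →⋆ₐ[ℂ] R :=
  starLift (IsoSpace.lift h.iso) fun a b r => by
    cases r with
    | question r =>
      have := r.map (IsoSpace.lift h.iso)
      rw [IsoSpace.vertex_map_lift] at this
      exact h.question _ _ this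
    | answer r =>
      have := r.map (IsoSpace.lift h.iso)
      rw [IsoSpace.edge_map_lift] at this
      exact h.answer _ _ this

theorem ONS.lift_vertex [StarModule ℂ R] (h : IsNSIso G₁ G₂ P Q) (v : X₁ × Y₁) (w : X₂ × Y₂) :
    ONS.lift h (ONS.vertex G₁ G₂ v w) = P v w := IsoSpace.lift_vertex h.iso v w

theorem ONS.lift_edge [StarModule ℂ R] (h : IsNSIso G₁ G₂ P Q) (v : A₁ × B₁) (w : A₂ × B₂) :
    ONS.lift h (ONS.edge G₁ G₂ v w) = Q v w := IsoSpace.lift_edge h.iso v w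

theorem HNS.lift_vertex {P : Matrix (X₁ × Y₁) (X₁ × Y₁) R} {Q : Matrix (A₁ × B₁) (A₁ × B₁) R}
    [StarModule ℂ R] (h : IsNSIso G₁ G₁ P Q) (v w : X₁ × Y₁) :
    HNS.lift h (HNS.vertex G₁ v w) = P v w := IsoSpace.lift_vertex h.iso v w

theorem HNS.lift_edge {P : Matrix (X₁ × Y₁) (X₁ × Y₁) R} {Q : Matrix (A₁ × B₁) (A₁ × B₁) R}
    [StarModule ℂ R] (h : IsNSIso G₁ G₁ P Q) (v w : A₁ × B₁) :
    HNS.lift h (HNS.edge G₁ v w) = Q v w := IsoSpace.lift_edge h.iso v w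

theorem ONS.algHom_ext {f f' : ONS G₁ G₂ →ₐ[ℂ] R}
    (hv : ∀ v w, f (ONS.vertex G₁ G₂ v w) = f' (ONS.vertex G₁ G₂ v w))
    (he : ∀ v w, f (ONS.edge G₁ G₂ v w) = f' (ONS.edge G₁ G₂ v w)) : f = f' := by
  have h : f.comp (ONS.quot G₁ G₂).toAlgHom = f'.comp (ONS.quot G₁ G₂).toAlgHom :=
    IsoSpace.algHom_ext hv he
  refine AlgHom.ext fun x => ?_
  obtain ⟨a, rfl⟩ := Ideal.Quotient.mk_surjective x
  exact DFunLike.congr_fun h a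

theorem ONS.induction {C : ONS G₁ G₂ → Prop} (scalar : ∀ c : ℂ, C (algebraMap ℂ (ONS G₁ G₂) c))
    (vertex : ∀ v w, C (ONS.vertex G₁ G₂ v w)) (edge : ∀ v w, C (ONS.edge G₁ G₂ v w))
    (mul : ∀ a b, C a → C b → C (a * b)) (add : ∀ a b, C a → C b → C (a + b))
    (x : ONS G₁ G₂) : C x := by
  obtain ⟨a, rfl⟩ := Ideal.Quotient.mk_surjective x
  induction a using IsoSpace.induction with
  | scalar c => exact scalar c
  | vertex v w => exact vertex v w
  | edge v w => exact edge v w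
  | mul a b ha hb => rw [map_mul]; exact mul _ _ ha hb
  | add a b ha hb => rw [map_add]; exact add _ _ ha hb

theorem HNS.induction {C : HNS G₁ → Prop} (scalar : ∀ c : ℂ, C (algebraMap ℂ (HNS G₁) c))
    (vertex : ∀ v w, C (HNS.vertex G₁ v w)) (edge : ∀ v w, C (HNS.edge G₁ v w))
    (mul : ∀ a b, C a → C b → C (a * b)) (add : ∀ a b, C a → C b → C (a + b))
    (x : HNS G₁) : C x := by
  obtain ⟨a, rfl⟩ := Ideal.Quotient.mk_surjective x
  induction a using IsoSpace.induction with
  | scalar c => exact scalar c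
  | vertex v w => exact vertex v w
  | edge v w => exact edge v w
  | mul a b ha hb => rw [map_mul]; exact mul _ _ ha hb
  | add a b ha hb => rw [map_add]; exact add _ _ ha hb

end NSIso

/-! ### Inverting the canonical maps by means of translation maps. -/

section CanonicalMaps

variable {H K Z : Type*} [Ring H] [StarRing H] [HopfAlgebra ℂ H] [HopfStarAlgebra H]
  [Ring K] [StarRing K] [HopfAlgebra ℂ K] [HopfStarAlgebra K]
  [Ring Z] [StarRing Z] [Algebra ℂ Z] [StarModule ℂ Z]

/-- The multiplication `Zᵐᵒᵖ ⊗ Z → Z`, `w ⊗ z ↦ w z`. -/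
def mulUnopLeft (Z : Type*) [Ring Z] [Algebra ℂ Z] : Zᵐᵒᵖ ⊗[ℂ] Z →ₗ[ℂ] Z :=
  LinearMap.mul' ℂ Z ∘ₗ (MulOpposite.opLinearEquiv ℂ).symm.toLinearMap.rTensor Z

/-- The multiplication `Z ⊗ Zᵐᵒᵖ → Z`, `z ⊗ w ↦ z w`. -/
def mulUnopRight (Z : Type*) [Ring Z] [Algebra ℂ Z] : Z ⊗[ℂ] Zᵐᵒᵖ →ₗ[ℂ] Z :=
  LinearMap.mul' ℂ Z ∘ₗ (MulOpposite.opLinearEquiv ℂ).symm.toLinearMap.lTensor Z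

/-- The map `H ⊗ Z → Z ⊗ Z`, `h ⊗ z ↦ ψ(h) (1 ⊗ z)`, the second leg of `ψ(h)` multiplying in `Z`. -/
def leftTranslation (ψ : H →ₗ[ℂ] Z ⊗[ℂ] Zᵐᵒᵖ) : H ⊗[ℂ] Z →ₗ[ℂ] Z ⊗[ℂ] Z :=
  (mulUnopLeft Z).lTensor Z ∘ₗ (TensorProduct.assoc ℂ Z Zᵐᵒᵖ Z).toLinearMap ∘ₗ ψ.rTensor Z

/-- The map `Z ⊗ K → Z ⊗ Z`, `z ⊗ k ↦ (z ⊗ 1) ψ(k)`, the first leg of `ψ(k)` multiplying in `Z`. -/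
def rightTranslation (ψ : K →ₗ[ℂ] Zᵐᵒᵖ ⊗[ℂ] Z) : Z ⊗[ℂ] K →ₗ[ℂ] Z ⊗[ℂ] Z :=
  (mulUnopRight Z).rTensor Z ∘ₗ (TensorProduct.assoc ℂ Z Zᵐᵒᵖ Z).symm.toLinearMap ∘ₗ ψ.lTensor Z

/-- Multiplication in the second leg of `ψ` is reversed, so the factor `b i` coming from `u` lands
directly next to `z`. This lets generators of `H` be peeled off from the left, although
`leftTranslation` is not multiplicative. -/
theorem leftTranslation_sum_mul {ι : Type*} [Fintype ι] {ψ : H →ₐ[ℂ] Z ⊗[ℂ] Zᵐᵒᵖ} {u : H}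
    {a b : ι → Z} (hu : ψ u = ∑ i, a i ⊗ₜ MulOpposite.op (b i)) (h : H) (z : Z) :
    leftTranslation ψ.toLinearMap ((u * h) ⊗ₜ z) =
      ∑ i, (a i ⊗ₜ 1) * leftTranslation ψ.toLinearMap (h ⊗ₜ (b i * z)) := by
  have key : ∀ t : Z ⊗[ℂ] Zᵐᵒᵖ, (mulUnopLeft Z).lTensor Z (TensorProduct.assoc ℂ Z Zᵐᵒᵖ Z
      (((∑ i, a i ⊗ₜ MulOpposite.op (b i)) * t) ⊗ₜ z)) =
      ∑ i, (a i ⊗ₜ 1) * (mulUnopLeft Z).lTensor Z (TensorProduct.assoc ℂ Z Zᵐᵒᵖ Z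
        (t ⊗ₜ (b i * z))) := by
    intro t
    induction t with
    | zero => simp
    | add x y hx hy => simp only [mul_add, TensorProduct.add_tmul, map_add, hx, hy,
        Finset.sum_add_distrib]
    | tmul x y =>
      rw [Finset.sum_mul, TensorProduct.sum_tmul, map_sum, map_sum]
      refine Finset.sum_congr rfl fun i _ => ?_
      simp [mulUnopLeft, mul_assoc]
  have := key (ψ h)
  rw [← hu, ← map_mul] at this
  exact this

theorem rightTranslation_mul_sum {ι : Type*} [Fintype ι] {ψ : K →ₐ[ℂ] Zᵐᵒᵖ ⊗[ℂ] Z} {u : K}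
    {a b : ι → Z} (hu : ψ u = ∑ i, MulOpposite.op (b i) ⊗ₜ a i) (k : K) (z : Z) :
    rightTranslation ψ.toLinearMap (z ⊗ₜ (k * u)) =
      ∑ i, rightTranslation ψ.toLinearMap ((z * b i) ⊗ₜ k) * (1 ⊗ₜ a i) := by
  have key : ∀ t : Zᵐᵒᵖ ⊗[ℂ] Z, (mulUnopRight Z).rTensor Z ((TensorProduct.assoc ℂ Z Zᵐᵒᵖ Z).symm
      (z ⊗ₜ (t * (∑ i, MulOpposite.op (b i) ⊗ₜ a i)))) =
      ∑ i, (mulUnopRight Z).rTensor Z ((TensorProduct.assoc ℂ Z Zᵐᵒᵖ Z).symm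
        ((z * b i) ⊗ₜ t)) * (1 ⊗ₜ a i) := by
    intro t
    induction t with
    | zero => simp
    | add x y hx hy => simp only [add_mul, TensorProduct.tmul_add, map_add, hx, hy,
        Finset.sum_add_distrib]
    | tmul x y =>
      rw [Finset.mul_sum, TensorProduct.tmul_sum, map_sum, map_sum]
      refine Finset.sum_congr rfl fun i _ => ?_
      simp [mulUnopRight, mul_assoc]
  have := key (ψ k)
  rw [← hu, ← map_mul] at this
  exact this

theorem leftTranslation_one_tmul (ψ : H →ₐ[ℂ] Z ⊗[ℂ] Zᵐᵒᵖ) (z : Z) :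
    leftTranslation ψ.toLinearMap (1 ⊗ₜ z) = 1 ⊗ₜ z := by
  simp [leftTranslation, mulUnopLeft, Algebra.TensorProduct.one_def]

theorem rightTranslation_tmul_one (ψ : K →ₐ[ℂ] Zᵐᵒᵖ ⊗[ℂ] Z) (z : Z) :
    rightTranslation ψ.toLinearMap (z ⊗ₜ 1) = z ⊗ₜ 1 := by
  simp [rightTranslation, mulUnopRight, Algebra.TensorProduct.one_def]

theorem leftCanonical_mul (δ : Z →⋆ₐ[ℂ] H ⊗[ℂ] Z) (a : Z) (t : Z ⊗[ℂ] Z) :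
    leftCanonical δ ((a ⊗ₜ 1) * t) = δ a * leftCanonical δ t := by
  induction t with
  | zero => simp
  | add x y hx hy => simp only [mul_add, map_add, hx, hy]
  | tmul x y =>
    rw [Algebra.TensorProduct.tmul_mul_tmul, one_mul, leftCanonical_tmul, leftCanonical_tmul,
      map_mul, mul_assoc]

theorem rightCanonical_mul (γ : Z →⋆ₐ[ℂ] Z ⊗[ℂ] K) (a : Z) (t : Z ⊗[ℂ] Z) :
    rightCanonical γ (t * (1 ⊗ₜ a)) = rightCanonical γ t * γ a := by
  induction t with
  | zero => simp
  | add x y hx hy => simp only [add_mul, map_add, hx, hy]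
  | tmul x y =>
    rw [Algebra.TensorProduct.tmul_mul_tmul, mul_one, rightCanonical_tmul, rightCanonical_tmul,
      map_mul, mul_assoc]

/-- The inverse is `leftTranslation`: `h₁` at $t=1\otimes z'$ is one inverse identity, and `h₂` at
$h'=1$ is the other. Keeping `h'` arbitrary in `h₂` makes the condition on `h` stable under
products, so it can be checked on generators. -/
theorem leftCanonical_bijective {δ : Z →⋆ₐ[ℂ] H ⊗[ℂ] Z} {ψ : H →ₐ[ℂ] Z ⊗[ℂ] Zᵐᵒᵖ}
    (h₁ : ∀ z t, leftTranslation ψ.toLinearMap (δ z * t) =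
      (z ⊗ₜ 1) * leftTranslation ψ.toLinearMap t)
    (h₂ : ∀ h h', (∀ z, leftCanonical δ (leftTranslation ψ.toLinearMap (h' ⊗ₜ z)) = h' ⊗ₜ z) →
      ∀ z, leftCanonical δ (leftTranslation ψ.toLinearMap ((h * h') ⊗ₜ z)) = (h * h') ⊗ₜ z) :
    Function.Bijective (leftCanonical δ) := by
  refine Function.bijective_iff_has_inverse.2 ⟨leftTranslation ψ.toLinearMap, fun t => ?_,
    fun t => ?_⟩
  · induction t with
    | zero => simp
    | add x y hx hy => rw [map_add, map_add, hx, hy]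
    | tmul x y =>
      rw [leftCanonical_tmul, h₁, leftTranslation_one_tmul, Algebra.TensorProduct.tmul_mul_tmul,
        mul_one, one_mul]
  · induction t with
    | zero => simp
    | add x y hx hy => rw [map_add, map_add, hx, hy]
    | tmul x y =>
      rw [← mul_one x]
      refine h₂ x 1 (fun z => ?_) y
      rw [leftTranslation_one_tmul, leftCanonical_tmul, map_one δ, one_mul]

theorem rightCanonical_bijective {γ : Z →⋆ₐ[ℂ] Z ⊗[ℂ] K} {ψ : K →ₐ[ℂ] Zᵐᵒᵖ ⊗[ℂ] Z}
    (h₁ : ∀ z t, rightTranslation ψ.toLinearMap (t * γ z) =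
      rightTranslation ψ.toLinearMap t * (1 ⊗ₜ z))
    (h₂ : ∀ k k', (∀ z, rightCanonical γ (rightTranslation ψ.toLinearMap (z ⊗ₜ k')) = z ⊗ₜ k') →
      ∀ z, rightCanonical γ (rightTranslation ψ.toLinearMap (z ⊗ₜ (k' * k))) = z ⊗ₜ (k' * k)) :
    Function.Bijective (rightCanonical γ) := by
  refine Function.bijective_iff_has_inverse.2 ⟨rightTranslation ψ.toLinearMap, fun t => ?_,
    fun t => ?_⟩
  · induction t with
    | zero => simp
    | add x y hx hy => rw [map_add, map_add, hx, hy]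
    | tmul x y =>
      rw [rightCanonical_tmul, h₁, rightTranslation_tmul_one, Algebra.TensorProduct.tmul_mul_tmul,
        mul_one, one_mul]
  · induction t with
    | zero => simp
    | add x y hx hy => rw [map_add, map_add, hx, hy]
    | tmul x y =>
      rw [← one_mul y]
      refine h₂ y 1 (fun z => ?_) x
      rw [rightTranslation_tmul_one, rightCanonical_tmul, map_one γ, mul_one]

section Blocks

variable {I J : Type*} [Fintype I] [Fintype J] {p : Matrix I J Z}

/-- The left side unfolds to $\sum_x u_{ix}h\otimes\sum_j p_{xj}p_{kj}z$, and the inner sum is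
$\delta_{xk}z$ by orthogonality of distinct entries in a column and the row sums. -/
theorem leftCanonical_leftTranslation_mul {u : Matrix I I H} (hp : IsMagicUnitary p)
    {δ : Z →⋆ₐ[ℂ] H ⊗[ℂ] Z} {ψ : H →ₐ[ℂ] Z ⊗[ℂ] Zᵐᵒᵖ}
    (hδ : ∀ i j, δ (p i j) = tensorMul u p i j)
    (hψ : ∀ i k, ψ (u i k) = ∑ j, p i j ⊗ₜ MulOpposite.op (p k j)) (i k : I) {h : H}
    (hh : ∀ z, leftCanonical δ (leftTranslation ψ.toLinearMap (h ⊗ₜ z)) = h ⊗ₜ z) (z : Z) :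
    leftCanonical δ (leftTranslation ψ.toLinearMap ((u i k * h) ⊗ₜ z)) = (u i k * h) ⊗ₜ z := by
  classical
  rw [leftTranslation_sum_mul (hψ i k), map_sum]
  simp only [leftCanonical_mul, hh, hδ, tensorMul, Finset.sum_mul,
    Algebra.TensorProduct.tmul_mul_tmul]
  rw [Finset.sum_comm]
  simp only [← TensorProduct.tmul_sum, ← mul_assoc, ← Finset.sum_mul, hp.sum_col_mul]
  rw [Finset.sum_eq_single k] <;> simp +contextual

/-- For $t=h\otimes z$ the inner sum is now $\sum_x p_{xl}p_{xj}z=\delta_{lj}z$, so only the term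
$p_{ij}\otimes1$ survives. -/
theorem leftTranslation_leftCanonical_mul {u : Matrix I I H} (hp : IsMagicUnitary p)
    {δ : Z →⋆ₐ[ℂ] H ⊗[ℂ] Z} {ψ : H →ₐ[ℂ] Z ⊗[ℂ] Zᵐᵒᵖ}
    (hδ : ∀ i j, δ (p i j) = tensorMul u p i j)
    (hψ : ∀ i k, ψ (u i k) = ∑ j, p i j ⊗ₜ MulOpposite.op (p k j)) (i : I) (j : J)
    (t : H ⊗[ℂ] Z) :
    leftTranslation ψ.toLinearMap (δ (p i j) * t) =
      (p i j ⊗ₜ 1) * leftTranslation ψ.toLinearMap t := by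
  classical
  induction t with
  | zero => simp
  | add x y hx hy => simp only [mul_add, map_add, hx, hy]
  | tmul h z =>
    simp only [hδ, tensorMul, Finset.sum_mul, map_sum, Algebra.TensorProduct.tmul_mul_tmul]
    simp only [leftTranslation_sum_mul (hψ i _)]
    rw [Finset.sum_comm]
    simp only [← Finset.mul_sum, ← map_sum, ← TensorProduct.tmul_sum, ← mul_assoc,
      ← Finset.sum_mul, hp.sum_row_mul]
    rw [Finset.sum_eq_single j] <;> simp +contextual

theorem rightCanonical_rightTranslation_mul {u : Matrix J J K} (hp : IsMagicUnitary p)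
    {γ : Z →⋆ₐ[ℂ] Z ⊗[ℂ] K} {ψ : K →ₐ[ℂ] Zᵐᵒᵖ ⊗[ℂ] Z}
    (hγ : ∀ i j, γ (p i j) = tensorMul p u i j)
    (hψ : ∀ j k, ψ (u j k) = ∑ i, MulOpposite.op (p i j) ⊗ₜ p i k) (j l : J) {k : K}
    (hk : ∀ z, rightCanonical γ (rightTranslation ψ.toLinearMap (z ⊗ₜ k)) = z ⊗ₜ k) (z : Z) :
    rightCanonical γ (rightTranslation ψ.toLinearMap (z ⊗ₜ (k * u j l))) = z ⊗ₜ (k * u j l) := by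
  classical
  rw [rightTranslation_mul_sum (hψ j l), map_sum]
  simp only [rightCanonical_mul, hk, hγ, tensorMul, Finset.mul_sum,
    Algebra.TensorProduct.tmul_mul_tmul]
  rw [Finset.sum_comm]
  simp only [← TensorProduct.sum_tmul, mul_assoc, ← Finset.mul_sum, hp.sum_row_mul]
  rw [Finset.sum_eq_single j] <;> simp +contextual [eq_comm]

theorem rightTranslation_rightCanonical_mul {u : Matrix J J K} (hp : IsMagicUnitary p)
    {γ : Z →⋆ₐ[ℂ] Z ⊗[ℂ] K} {ψ : K →ₐ[ℂ] Zᵐᵒᵖ ⊗[ℂ] Z}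
    (hγ : ∀ i j, γ (p i j) = tensorMul p u i j)
    (hψ : ∀ j k, ψ (u j k) = ∑ i, MulOpposite.op (p i j) ⊗ₜ p i k) (i : I) (j : J)
    (t : Z ⊗[ℂ] K) :
    rightTranslation ψ.toLinearMap (t * γ (p i j)) =
      rightTranslation ψ.toLinearMap t * (1 ⊗ₜ p i j) := by
  classical
  induction t with
  | zero => simp
  | add x y hx hy => simp only [add_mul, map_add, hx, hy]
  | tmul z k =>
    simp only [hγ, tensorMul, Finset.mul_sum, map_sum, Algebra.TensorProduct.tmul_mul_tmul]
    simp only [rightTranslation_mul_sum (hψ _ j)]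
    rw [Finset.sum_comm]
    simp only [← Finset.sum_mul, ← map_sum, ← TensorProduct.sum_tmul, mul_assoc,
      ← Finset.mul_sum, hp.sum_col_mul]
    rw [Finset.sum_eq_single i] <;> simp +contextual [eq_comm]

end Blocks

end CanonicalMaps

/-! ### The Hopf $*$-algebra structure on the automorphism quotients. -/

section HopfIdeal

variable {X Y A B : Type*} [Fintype X] [Fintype Y] [Fintype A] [Fintype B]
  (G : NonlocalGame X Y A B)

theorem HNS.comul_quot (a : IsoSpace G.hypergraph G.hypergraph) :
    HNS.lift ((HNS.isNSIso G).tensorMul (HNS.isNSIso G)) (HNS.quot G a) =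
      Algebra.TensorProduct.map (HNS.quot G).toAlgHom (HNS.quot G).toAlgHom
        (IsoSpace.comp _ _ _ a) := by
  refine DFunLike.congr_fun (f := (HNS.lift ((HNS.isNSIso G).tensorMul
    (HNS.isNSIso G))).toAlgHom.comp (HNS.quot G).toAlgHom)
    (g := (Algebra.TensorProduct.map (HNS.quot G).toAlgHom (HNS.quot G).toAlgHom).comp
      (IsoSpace.comp _ _ _).toAlgHom) (IsoSpace.algHom_ext (fun v w => ?_) (fun v w => ?_)) a
  · refine (HNS.lift_vertex ((HNS.isNSIso G).tensorMul (HNS.isNSIso G)) v w).trans ?_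
    simp only [AlgHom.comp_apply, StarAlgHom.coe_toAlgHom, IsoSpace.comp_vertex, map_sum]
    rfl
  · refine (HNS.lift_edge ((HNS.isNSIso G).tensorMul (HNS.isNSIso G)) v w).trans ?_
    simp only [AlgHom.comp_apply, StarAlgHom.coe_toAlgHom, IsoSpace.comp_edge, map_sum]
    rfl

theorem HNS.counit_quot [DecidableEq (X × Y)] [DecidableEq (A × B)]
    (a : IsoSpace G.hypergraph G.hypergraph) :
    HNS.lift (isNSIso_one G) (HNS.quot G a) = IsoSpace.counit _ a := by
  refine DFunLike.congr_fun (f := (HNS.lift (isNSIso_one G)).toAlgHom.comp (HNS.quot G).toAlgHom)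
    (g := (IsoSpace.counit _).toAlgHom) (IsoSpace.algHom_ext (fun v w => ?_) (fun v w => ?_)) a
  · refine (HNS.lift_vertex (isNSIso_one G) v w).trans ?_
    change _ = IsoSpace.counit _ (IsoSpace.vertex G.hypergraph G.hypergraph v w)
    rw [IsoSpace.counit_vertex, Matrix.one_apply]
    congr
  · refine (HNS.lift_edge (isNSIso_one G) v w).trans ?_
    change _ = IsoSpace.counit _ (IsoSpace.edge G.hypergraph G.hypergraph v w)
    rw [IsoSpace.counit_edge, Matrix.one_apply]
    congr

/-- The antipode reverses products, so it descends as a homomorphism into the opposite algebra,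
induced by the transposed matrices. This is where invariance of the marginals under transposition
enters for $J$. -/
theorem HNS.antipode_quot (a : IsoSpace G.hypergraph G.hypergraph) :
    (HNS.lift (HNS.isNSIso G).transpose_op (HNS.quot G a)).unop =
      HNS.quot G (IsoSpace.antipode _ a) := by
  induction a using IsoSpace.induction with
  | scalar c =>
    rw [AlgHomClass.commutes, AlgHomClass.commutes, Algebra.algebraMap_eq_smul_one,
      Algebra.algebraMap_eq_smul_one, map_smul, IsoSpace.antipode_one, map_smul, map_one]
    rfl
  | vertex v w => rw [IsoSpace.antipode_vertex]; exact congrArg _ (HNS.lift_vertex _ v w)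
  | edge v w => rw [IsoSpace.antipode_edge]; exact congrArg _ (HNS.lift_edge _ v w)
  | mul a b ha hb =>
    rw [map_mul, map_mul, MulOpposite.unop_mul, ha, hb, IsoSpace.antipode_mul, map_mul]
  | add a b ha hb => rw [map_add, map_add, MulOpposite.unop_add, ha, hb, map_add, map_add]

instance autNSIdeal_isHopfIdeal : (autNSIdeal G).IsHopfIdeal ℂ where
  counit_eq_zero x hx := by
    -- Each structure map, followed by the quotient maps on its target, factors through $\mathcal
    -- O(\Lambda)/J$, and therefore kills $J$.
    have h0 : HNS.quot G x = 0 := Ideal.Quotient.eq_zero_iff_mem.2 hx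
    classical
    have := HNS.counit_quot G x
    rw [h0, map_zero] at this
    exact this.symm
  map_mkQ_comul_eq_zero x hx := by
    have h0 : HNS.quot G x = 0 := Ideal.Quotient.eq_zero_iff_mem.2 hx
    have := HNS.comul_quot G x
    rw [h0, map_zero] at this
    exact this.symm
  antipode_mem x hx := by
    have h0 : HNS.quot G x = 0 := Ideal.Quotient.eq_zero_iff_mem.2 hx
    have := HNS.antipode_quot G x
    rw [h0, map_zero] at this
    exact Ideal.Quotient.eq_zero_iff_mem.1 this.symm

/-- Identifies the quotient coproduct with a map that is a $*$-homomorphism by construction, which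
gives its compatibility with the involution. -/
theorem HNS.comul_eq (x : HNS G) : Coalgebra.comul (R := ℂ) x =
    HNS.lift ((HNS.isNSIso G).tensorMul (HNS.isNSIso G)) x := by
  obtain ⟨a, rfl⟩ := Ideal.Quotient.mk_surjective x
  exact (HNS.comul_quot G a).symm

theorem HNS.counit_eq [DecidableEq (X × Y)] [DecidableEq (A × B)] (x : HNS G) :
    Coalgebra.counit (R := ℂ) x = HNS.lift (isNSIso_one G) x := by
  obtain ⟨a, rfl⟩ := Ideal.Quotient.mk_surjective x
  exact (HNS.counit_quot G a).symm

instance HNS.hopfStarAlgebra : HopfStarAlgebra (HNS G) where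
  star_smul := star_smul
  comul_star a := by rw [HNS.comul_eq, HNS.comul_eq, map_star]
  counit_star a := by classical rw [HNS.counit_eq, HNS.counit_eq, map_star]

end HopfIdeal

/-! ### The coactions on the no-signalling quotient and the bi-Galois property. -/

section NSCoactions

variable {X₁ Y₁ A₁ B₁ X₂ Y₂ A₂ B₂ : Type*} [Fintype X₁] [Fintype Y₁] [Fintype A₁] [Fintype B₁]
  [Fintype X₂] [Fintype Y₂] [Fintype A₂] [Fintype B₂]
  (G₁ : NonlocalGame X₁ Y₁ A₁ B₁) (G₂ : NonlocalGame X₂ Y₂ A₂ B₂)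

/-- The left coaction of `O(Λ_{G₁}) / J₁` on `O_NS(G₁, G₂)`. -/
def ONS.leftCoaction : ONS G₁ G₂ →⋆ₐ[ℂ] HNS G₁ ⊗[ℂ] ONS G₁ G₂ :=
  ONS.lift ((HNS.isNSIso G₁).tensorMul (ONS.isNSIso G₁ G₂))

/-- The right coaction of `O(Λ_{G₂}) / J₂` on `O_NS(G₁, G₂)`. -/
def ONS.rightCoaction : ONS G₁ G₂ →⋆ₐ[ℂ] ONS G₁ G₂ ⊗[ℂ] HNS G₂ :=
  ONS.lift ((ONS.isNSIso G₁ G₂).tensorMul (HNS.isNSIso G₂))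

theorem ONS.leftCoaction_vertex (v : X₁ × Y₁) (w : X₂ × Y₂) :
    ONS.leftCoaction G₁ G₂ (ONS.vertex G₁ G₂ v w) =
      ∑ x, HNS.vertex G₁ v x ⊗ₜ ONS.vertex G₁ G₂ x w := ONS.lift_vertex _ v w

theorem ONS.leftCoaction_edge (v : A₁ × B₁) (w : A₂ × B₂) :
    ONS.leftCoaction G₁ G₂ (ONS.edge G₁ G₂ v w) =
      ∑ x, HNS.edge G₁ v x ⊗ₜ ONS.edge G₁ G₂ x w := ONS.lift_edge _ v w

theorem ONS.rightCoaction_vertex (v : X₁ × Y₁) (w : X₂ × Y₂) :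
    ONS.rightCoaction G₁ G₂ (ONS.vertex G₁ G₂ v w) =
      ∑ x, ONS.vertex G₁ G₂ v x ⊗ₜ HNS.vertex G₂ x w := ONS.lift_vertex _ v w

theorem ONS.rightCoaction_edge (v : A₁ × B₁) (w : A₂ × B₂) :
    ONS.rightCoaction G₁ G₂ (ONS.edge G₁ G₂ v w) =
      ∑ x, ONS.edge G₁ G₂ v x ⊗ₜ HNS.edge G₂ x w := ONS.lift_edge _ v w

theorem HNS.comul_vertex (v w : X₁ × Y₁) : Coalgebra.comul (R := ℂ) (HNS.vertex G₁ v w) =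
    ∑ x, HNS.vertex G₁ v x ⊗ₜ[ℂ] HNS.vertex G₁ x w :=
  (HNS.comul_eq _ _).trans (HNS.lift_vertex _ v w)

theorem HNS.comul_edge (v w : A₁ × B₁) : Coalgebra.comul (R := ℂ) (HNS.edge G₁ v w) =
    ∑ x, HNS.edge G₁ v x ⊗ₜ[ℂ] HNS.edge G₁ x w :=
  (HNS.comul_eq _ _).trans (HNS.lift_edge _ v w)

theorem HNS.counit_vertex [DecidableEq (X₁ × Y₁)] (v w : X₁ × Y₁) :
    Coalgebra.counit (R := ℂ) (HNS.vertex G₁ v w) = if v = w then 1 else 0 := by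
  classical
  exact (HNS.counit_eq _ _).trans ((HNS.lift_vertex (isNSIso_one G₁) v w).trans Matrix.one_apply)

theorem HNS.counit_edge [DecidableEq (A₁ × B₁)] (v w : A₁ × B₁) :
    Coalgebra.counit (R := ℂ) (HNS.edge G₁ v w) = if v = w then 1 else 0 := by
  classical
  exact (HNS.counit_eq _ _).trans ((HNS.lift_edge (isNSIso_one G₁) v w).trans Matrix.one_apply)

theorem ONS.leftCoaction_quot (a : IsoSpace G₁.hypergraph G₂.hypergraph) :
    ONS.leftCoaction G₁ G₂ (ONS.quot G₁ G₂ a) =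
      Algebra.TensorProduct.map (HNS.quot G₁).toAlgHom (ONS.quot G₁ G₂).toAlgHom
        (QIso.leftCoaction G₁.hypergraph G₂.hypergraph a) := by
  refine DFunLike.congr_fun (f := (ONS.leftCoaction G₁ G₂).toAlgHom.comp (ONS.quot G₁ G₂).toAlgHom)
    (g := (Algebra.TensorProduct.map (HNS.quot G₁).toAlgHom (ONS.quot G₁ G₂).toAlgHom).comp
      (QIso.leftCoaction _ _).toAlgHom) (IsoSpace.algHom_ext (fun v w => ?_) (fun v w => ?_)) a
  · refine (ONS.leftCoaction_vertex G₁ G₂ v w).trans ?_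
    simp only [AlgHom.comp_apply, StarAlgHom.coe_toAlgHom, QIso.leftCoaction,
      IsoSpace.comp_vertex, map_sum]
    rfl
  · refine (ONS.leftCoaction_edge G₁ G₂ v w).trans ?_
    simp only [AlgHom.comp_apply, StarAlgHom.coe_toAlgHom, QIso.leftCoaction,
      IsoSpace.comp_edge, map_sum]
    rfl

theorem ONS.rightCoaction_quot (a : IsoSpace G₁.hypergraph G₂.hypergraph) :
    ONS.rightCoaction G₁ G₂ (ONS.quot G₁ G₂ a) =
      Algebra.TensorProduct.map (ONS.quot G₁ G₂).toAlgHom (HNS.quot G₂).toAlgHom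
        (QIso.rightCoaction G₁.hypergraph G₂.hypergraph a) := by
  refine DFunLike.congr_fun (f := (ONS.rightCoaction G₁ G₂).toAlgHom.comp (ONS.quot G₁ G₂).toAlgHom)
    (g := (Algebra.TensorProduct.map (ONS.quot G₁ G₂).toAlgHom (HNS.quot G₂).toAlgHom).comp
      (QIso.rightCoaction _ _).toAlgHom) (IsoSpace.algHom_ext (fun v w => ?_) (fun v w => ?_)) a
  · refine (ONS.rightCoaction_vertex G₁ G₂ v w).trans ?_
    simp only [AlgHom.comp_apply, StarAlgHom.coe_toAlgHom, QIso.rightCoaction,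
      IsoSpace.comp_vertex, map_sum]
    rfl
  · refine (ONS.rightCoaction_edge G₁ G₂ v w).trans ?_
    simp only [AlgHom.comp_apply, StarAlgHom.coe_toAlgHom, QIso.rightCoaction,
      IsoSpace.comp_edge, map_sum]
    rfl

theorem ONS.isLeftCoaction : IsLeftCoaction (ONS.leftCoaction G₁ G₂) where
  coassoc z := by
    -- Both sides are values of unital algebra homomorphisms, so the identity need only be checked
    -- on generators, where it is associativity of the matrix product.
    refine DFunLike.congr_fun
      (f := (Algebra.TensorProduct.map (AlgHom.id ℂ (HNS G₁))
        (ONS.leftCoaction G₁ G₂).toAlgHom).comp (ONS.leftCoaction G₁ G₂).toAlgHom)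
      (g := ((Algebra.TensorProduct.assoc ℂ ℂ ℂ (HNS G₁) (HNS G₁) (ONS G₁ G₂)).toAlgHom.comp
        (Algebra.TensorProduct.map (Bialgebra.comulAlgHom ℂ (HNS G₁)) (AlgHom.id ℂ _))).comp
        (ONS.leftCoaction G₁ G₂).toAlgHom)
      (ONS.algHom_ext (fun v w => ?_) (fun v w => ?_)) z
    · simp [ONS.leftCoaction_vertex, HNS.comul_vertex, TensorProduct.sum_tmul,
        TensorProduct.tmul_sum]
      exact Finset.sum_comm
    · simp [ONS.leftCoaction_edge, HNS.comul_edge, TensorProduct.sum_tmul,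
        TensorProduct.tmul_sum]
      exact Finset.sum_comm
  counit z := by
    classical
    refine DFunLike.congr_fun
      (f := ((Algebra.TensorProduct.lid ℂ (ONS G₁ G₂)).toAlgHom.comp
        (Algebra.TensorProduct.map (Bialgebra.counitAlgHom ℂ (HNS G₁)) (AlgHom.id ℂ _))).comp
        (ONS.leftCoaction G₁ G₂).toAlgHom)
      (g := AlgHom.id ℂ _)
      (ONS.algHom_ext (fun v w => ?_) (fun v w => ?_)) z
    · simp [ONS.leftCoaction_vertex, HNS.counit_vertex]
    · simp [ONS.leftCoaction_edge, HNS.counit_edge]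

theorem ONS.isRightCoaction : IsRightCoaction (ONS.rightCoaction G₁ G₂) where
  coassoc z := by
    refine DFunLike.congr_fun
      (f := ((Algebra.TensorProduct.assoc ℂ ℂ ℂ (ONS G₁ G₂) (HNS G₂) (HNS G₂)).toAlgHom.comp
        (Algebra.TensorProduct.map (ONS.rightCoaction G₁ G₂).toAlgHom (AlgHom.id ℂ _))).comp
        (ONS.rightCoaction G₁ G₂).toAlgHom)
      (g := (Algebra.TensorProduct.map (AlgHom.id ℂ (ONS G₁ G₂))
        (Bialgebra.comulAlgHom ℂ (HNS G₂))).comp (ONS.rightCoaction G₁ G₂).toAlgHom)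
      (ONS.algHom_ext (fun v w => ?_) (fun v w => ?_)) z
    · simp [ONS.rightCoaction_vertex, HNS.comul_vertex, TensorProduct.sum_tmul,
        TensorProduct.tmul_sum]
      exact Finset.sum_comm
    · simp [ONS.rightCoaction_edge, HNS.comul_edge, TensorProduct.sum_tmul,
        TensorProduct.tmul_sum]
      exact Finset.sum_comm
  counit z := by
    classical
    refine DFunLike.congr_fun
      (f := ((Algebra.TensorProduct.rid ℂ ℂ (ONS G₁ G₂)).toAlgHom.comp
        (Algebra.TensorProduct.map (AlgHom.id ℂ _) (Bialgebra.counitAlgHom ℂ (HNS G₂)))).comp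
        (ONS.rightCoaction G₁ G₂).toAlgHom)
      (g := AlgHom.id ℂ _)
      (ONS.algHom_ext (fun v w => ?_) (fun v w => ?_)) z
    · simp [ONS.rightCoaction_vertex, HNS.counit_vertex]
    · simp [ONS.rightCoaction_edge, HNS.counit_edge]

theorem ONS.coactions_commute (z : ONS G₁ G₂) :
    TensorProduct.assoc ℂ (HNS G₁) (ONS G₁ G₂) (HNS G₂)
      (TensorProduct.map (ONS.leftCoaction G₁ G₂).toAlgHom.toLinearMap LinearMap.id
        (ONS.rightCoaction G₁ G₂ z)) =
    TensorProduct.map LinearMap.id (ONS.rightCoaction G₁ G₂).toAlgHom.toLinearMap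
      (ONS.leftCoaction G₁ G₂ z) := by
  refine DFunLike.congr_fun
    (f := ((Algebra.TensorProduct.assoc ℂ ℂ ℂ (HNS G₁) (ONS G₁ G₂) (HNS G₂)).toAlgHom.comp
      (Algebra.TensorProduct.map (ONS.leftCoaction G₁ G₂).toAlgHom (AlgHom.id ℂ _))).comp
      (ONS.rightCoaction G₁ G₂).toAlgHom)
    (g := (Algebra.TensorProduct.map (AlgHom.id ℂ (HNS G₁))
      (ONS.rightCoaction G₁ G₂).toAlgHom).comp (ONS.leftCoaction G₁ G₂).toAlgHom)
    (ONS.algHom_ext (fun v w => ?_) (fun v w => ?_)) z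
  · simp [ONS.leftCoaction_vertex, ONS.rightCoaction_vertex, TensorProduct.sum_tmul,
      TensorProduct.tmul_sum]
    exact Finset.sum_comm
  · simp [ONS.leftCoaction_edge, ONS.rightCoaction_edge, TensorProduct.sum_tmul,
      TensorProduct.tmul_sum]
    exact Finset.sum_comm

theorem ONS.leftCanonical_bijective :
    Function.Bijective (leftCanonical (ONS.leftCoaction G₁ G₂)) := by
  -- The translation map: composing the universal isomorphism from $\mathcal G_1$ to $\mathcal G_2$
  -- with its reversed transpose gives a no-signalling isomorphism from $\mathcal G_1$ to itself,
  -- hence a homomorphism on $H_1$.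
  let ψ := (HNS.lift ((ONS.isNSIso G₁ G₂).tensorMul (ONS.isNSIso G₁ G₂).transpose_op)).toAlgHom
  have hδv := ONS.leftCoaction_vertex G₁ G₂
  have hδe := ONS.leftCoaction_edge G₁ G₂
  have hψv := HNS.lift_vertex ((ONS.isNSIso G₁ G₂).tensorMul (ONS.isNSIso G₁ G₂).transpose_op)
  have hψe := HNS.lift_edge ((ONS.isNSIso G₁ G₂).tensorMul (ONS.isNSIso G₁ G₂).transpose_op)
  have hv := (ONS.isNSIso G₁ G₂).iso.magic_vertex
  have he := (ONS.isNSIso G₁ G₂).iso.magic_edge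
  refine QIso.leftCanonical_bijective (ψ := ψ) ?_ ?_
  · intro z
    induction z using ONS.induction with
    | scalar c => intro t; simp [Algebra.algebraMap_eq_smul_one, ← TensorProduct.smul_tmul',
        ← Algebra.TensorProduct.one_def]
    | vertex v w => exact leftTranslation_leftCanonical_mul hv hδv hψv v w
    | edge v w => exact leftTranslation_leftCanonical_mul he hδe hψe v w
    | mul a b ha hb =>
      intro t
      rw [map_mul (ONS.leftCoaction G₁ G₂), mul_assoc, ha, hb, ← mul_assoc,
        Algebra.TensorProduct.tmul_mul_tmul, one_mul]
    | add a b ha hb =>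
      intro t
      rw [map_add, add_mul, map_add, ha, hb, TensorProduct.add_tmul, add_mul]
  · intro h
    induction h using HNS.induction with
    | scalar c =>
      intro h' hh z
      rw [← Algebra.smul_def, ← TensorProduct.smul_tmul', map_smul, map_smul, hh]
    | vertex v w =>
      exact fun h' hh => leftCanonical_leftTranslation_mul hv hδv hψv v w hh
    | edge v w => exact fun h' hh => leftCanonical_leftTranslation_mul he hδe hψe v w hh
    | mul a b ha hb =>
      intro h' hh
      rw [mul_assoc]
      -- The factor `b` is absorbed into `h'` first, and then `a` acts on `b * h'`.
      exact ha _ (hb _ hh)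
    | add a b ha hb =>
      intro h' hh z
      rw [add_mul, TensorProduct.add_tmul, map_add, map_add, ha _ hh, hb _ hh]

theorem ONS.rightCanonical_bijective :
    Function.Bijective (rightCanonical (ONS.rightCoaction G₁ G₂)) := by
  -- The composition in the other order starts and ends at $\mathcal G_2$, so it is defined on
  -- $H_2$, with the opposite algebra in the first leg.
  let ψ := (HNS.lift ((ONS.isNSIso G₁ G₂).transpose_op.tensorMul (ONS.isNSIso G₁ G₂))).toAlgHom
  have hγv := ONS.rightCoaction_vertex G₁ G₂
  have hγe := ONS.rightCoaction_edge G₁ G₂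
  have hψv := HNS.lift_vertex ((ONS.isNSIso G₁ G₂).transpose_op.tensorMul (ONS.isNSIso G₁ G₂))
  have hψe := HNS.lift_edge ((ONS.isNSIso G₁ G₂).transpose_op.tensorMul (ONS.isNSIso G₁ G₂))
  have hv := (ONS.isNSIso G₁ G₂).iso.magic_vertex
  have he := (ONS.isNSIso G₁ G₂).iso.magic_edge
  refine QIso.rightCanonical_bijective (ψ := ψ) ?_ ?_
  · intro z
    induction z using ONS.induction with
    | scalar c => intro t; simp [Algebra.algebraMap_eq_smul_one, TensorProduct.tmul_smul,
        ← Algebra.TensorProduct.one_def]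
    | vertex v w => exact rightTranslation_rightCanonical_mul hv hγv hψv v w
    | edge v w => exact rightTranslation_rightCanonical_mul he hγe hψe v w
    | mul a b ha hb =>
      intro t
      rw [map_mul (ONS.rightCoaction G₁ G₂), ← mul_assoc, hb, ha, mul_assoc,
        Algebra.TensorProduct.tmul_mul_tmul, one_mul]
    | add a b ha hb =>
      intro t
      rw [map_add, mul_add, map_add, ha, hb, TensorProduct.tmul_add, mul_add]
  · intro k
    induction k using HNS.induction with
    | scalar c =>
      intro k' hk z
      rw [← Algebra.commutes, ← Algebra.smul_def, TensorProduct.tmul_smul, map_smul, map_smul,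
        hk]
    | vertex v w =>
      exact fun k' hk => rightCanonical_rightTranslation_mul hv hγv hψv v w hk
    | edge v w => exact fun k' hk => rightCanonical_rightTranslation_mul he hγe hψe v w hk
    | mul a b ha hb =>
      intro k' hk
      rw [← mul_assoc]
      -- On this side factors are appended on the right, so `a` is absorbed into `k'` before `b`.
      exact hb _ (ha _ hk)
    | add a b ha hb =>
      intro k' hk z
      rw [mul_add, TensorProduct.tmul_add, map_add, map_add, ha _ hk, hb _ hk]

theorem ONS.leftCanonical_quot
    (t : IsoSpace G₁.hypergraph G₂.hypergraph ⊗[ℂ] IsoSpace G₁.hypergraph G₂.hypergraph) :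
    leftCanonical (ONS.leftCoaction G₁ G₂)
      (Algebra.TensorProduct.map (ONS.quot G₁ G₂).toAlgHom (ONS.quot G₁ G₂).toAlgHom t) =
    Algebra.TensorProduct.map (HNS.quot G₁).toAlgHom (ONS.quot G₁ G₂).toAlgHom
      (leftCanonical (QIso.leftCoaction G₁.hypergraph G₂.hypergraph) t) := by
  induction t with
  | zero => simp
  | add x y hx hy => simp only [map_add, hx, hy]
  | tmul x y =>
    rw [leftCanonical_tmul, map_mul, ← ONS.leftCoaction_quot, Algebra.TensorProduct.map_tmul,
      Algebra.TensorProduct.map_tmul, leftCanonical_tmul, map_one]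
    rfl

theorem ONS.rightCanonical_quot
    (t : IsoSpace G₁.hypergraph G₂.hypergraph ⊗[ℂ] IsoSpace G₁.hypergraph G₂.hypergraph) :
    rightCanonical (ONS.rightCoaction G₁ G₂)
      (Algebra.TensorProduct.map (ONS.quot G₁ G₂).toAlgHom (ONS.quot G₁ G₂).toAlgHom t) =
    Algebra.TensorProduct.map (ONS.quot G₁ G₂).toAlgHom (HNS.quot G₂).toAlgHom
      (rightCanonical (QIso.rightCoaction G₁.hypergraph G₂.hypergraph) t) := by
  induction t with
  | zero => simp
  | add x y hx hy => simp only [map_add, hx, hy]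
  | tmul x y =>
    rw [rightCanonical_tmul, map_mul, ← ONS.rightCoaction_quot, Algebra.TensorProduct.map_tmul,
      Algebra.TensorProduct.map_tmul, rightCanonical_tmul, map_one]
    rfl

end NSCoactions

end QIso

end

theorem mainTheorem10 {X₁ Y₁ A₁ B₁ X₂ Y₂ A₂ B₂ : Type*}
    [Fintype X₁] [Fintype Y₁] [Fintype A₁] [Fintype B₁]
    [Fintype X₂] [Fintype Y₂] [Fintype A₂] [Fintype B₂]
    (G₁ : NonlocalGame X₁ Y₁ A₁ B₁) (G₂ : NonlocalGame X₂ Y₂ A₂ B₂) :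
    ∃ (_ : (autNSIdeal G₁).IsHopfIdeal ℂ) (_ : (autNSIdeal G₂).IsHopfIdeal ℂ)
      (_ : HopfStarAlgebra (HNS G₁)) (_ : HopfStarAlgebra (HNS G₂))
      (δ' : ONS G₁ G₂ →⋆ₐ[ℂ] HNS G₁ ⊗[ℂ] ONS G₁ G₂)
      (γ' : ONS G₁ G₂ →⋆ₐ[ℂ] ONS G₁ G₂ ⊗[ℂ] HNS G₂),
      (∀ a, δ' (ONS.quot G₁ G₂ a) =
        Algebra.TensorProduct.map (HNS.quot G₁).toAlgHom (ONS.quot G₁ G₂).toAlgHom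
          (leftCoaction G₁.hypergraph G₂.hypergraph a)) ∧
      (∀ a, γ' (ONS.quot G₁ G₂ a) =
        Algebra.TensorProduct.map (ONS.quot G₁ G₂).toAlgHom (HNS.quot G₂).toAlgHom
          (rightCoaction G₁.hypergraph G₂.hypergraph a)) ∧
      (∀ t, leftCanonical δ'
          (Algebra.TensorProduct.map (ONS.quot G₁ G₂).toAlgHom (ONS.quot G₁ G₂).toAlgHom t) =
        Algebra.TensorProduct.map (HNS.quot G₁).toAlgHom (ONS.quot G₁ G₂).toAlgHom
          (leftCanonical (leftCoaction G₁.hypergraph G₂.hypergraph) t)) ∧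
      (∀ t, rightCanonical γ'
          (Algebra.TensorProduct.map (ONS.quot G₁ G₂).toAlgHom (ONS.quot G₁ G₂).toAlgHom t) =
        Algebra.TensorProduct.map (ONS.quot G₁ G₂).toAlgHom (HNS.quot G₂).toAlgHom
          (rightCanonical (rightCoaction G₁.hypergraph G₂.hypergraph) t)) ∧
      IsBiGalois δ' γ' := by
  exact ⟨autNSIdeal_isHopfIdeal G₁, autNSIdeal_isHopfIdeal G₂, HNS.hopfStarAlgebra G₁,
    HNS.hopfStarAlgebra G₂, ONS.leftCoaction G₁ G₂, ONS.rightCoaction G₁ G₂,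
    ONS.leftCoaction_quot G₁ G₂, ONS.rightCoaction_quot G₁ G₂, ONS.leftCanonical_quot G₁ G₂,
    ONS.rightCanonical_quot G₁ G₂,
    { left := ONS.isLeftCoaction G₁ G₂
      right := ONS.isRightCoaction G₁ G₂
      commute := ONS.coactions_commute G₁ G₂
      left_bijective := ONS.leftCanonical_bijective G₁ G₂
      right_bijective := ONS.rightCanonical_bijective G₁ G₂ }⟩
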